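/- Let $n\ge 1$ and $0<\alpha<n$. For $1\le i\le n$ and a compact set $E\subset\mathbb{R}^n$, the capacity associated with the $i$-th scalar $\alpha$-Riesz potential is $$\kappa_{\alpha,i}(E)=\sup\left\{|\langle T,1\rangle| : \operatorname{spt}(T)\subset E,\ \left\|\frac{x_i}{|x|^{1+\alpha}}*T\right\|_\infty\le 1\right\},$$ where $T$ ranges over the real distributions on $\mathbb{R}^n$, and the condition on the potential means that the distribution $\frac{x_i}{|x|^{1+\alpha}}*T$ is (integration against) a function in the closed unit ball of $L^\infty(\mathbb{R}^n)$. Then there is a constant $C>0$, depending only on $n$ and $\alpha$, such that $$\kappa_{\alpha,i}(E)\le C\,\operatorname{diam}(E)^\alpha$$ for every compact set $E\subset\mathbb{R}^n$ and every $1\le i\le n$. In particular, $\kappa_{\alpha,i}(E)$ is finite. -/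

import Mathlib

open MeasureTheory TopologicalSpace Distribution Filter
open scoped Distributions ContDiff Topology ENNReal Manifold Convolution

namespace ScalarRiesz

/-! ### The pairing of a compactly supported distribution with a smooth function -/

section Pairing

variable {V : Type*} [NormedAddCommGroup V] [NormedSpace ℝ V]

/-- The test function `χ f`, where `χ` is a test function and `f` is smooth. -/
noncomputable def mulSmooth (χ : 𝓓((⊤ : Opens V), ℝ)) (f : V → ℝ) (hf : ContDiff ℝ ∞ f) :
    𝓓((⊤ : Opens V), ℝ) where
  toFun := fun x => χ x * f x
  contDiff' := χ.contDiff.mul hf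
  hasCompactSupport' := χ.hasCompactSupport.mul_right
  tsupport_subset' := by simp

/-- Compact sets have smooth cutoff functions. -/
theorem exists_cutoff [FiniteDimensional ℝ V] {K : Set V} (hK : IsCompact K) :
    ∃ χ : 𝓓((⊤ : Opens V), ℝ), ∀ᶠ x in 𝓝ˢ K, χ x = 1 := by
  obtain ⟨L, hL, hKL⟩ := exists_compact_superset hK
  obtain ⟨f, h1, h0, -⟩ := exists_contMDiffMap_one_nhds_of_subset_interior (n := (⊤ : ℕ∞))
    𝓘(ℝ, V) hK.isClosed hKL
  exact ⟨⟨f, f.contMDiff.contDiff, HasCompactSupport.intro hL h0, by simp⟩, h1⟩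

open Classical in
/-- The pairing `⟨T, f⟩` of a compactly supported distribution `T` with a smooth function `f`, which
need not be compactly supported: `⟨T, f⟩ = ⟨T, χ f⟩`, where `χ` is a test function equal to one in
a neighbourhood of the support of `T`. It does not depend on `χ`, see `pairing_eq`.
(Only used when `T` has compact support and `f` is smooth.) -/
noncomputable def pairing [FiniteDimensional ℝ V] (T : 𝓓'((⊤ : Opens V), ℝ)) (f : V → ℝ) : ℝ :=
  if h : IsCompact (dsupport T) ∧ ContDiff ℝ ∞ f then
    T (mulSmooth (exists_cutoff h.1).choose f h.2)
  else 0

/-- A distribution vanishes on test functions supported away from its support. -/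
theorem apply_eq_zero [FiniteDimensional ℝ V] (T : 𝓓'((⊤ : Opens V), ℝ)) (u : 𝓓((⊤ : Opens V), ℝ))
    (hu : tsupport u ⊆ (dsupport T)ᶜ) : T u = 0 := by
  rw [dsupport_compl_eq, Set.sUnion_eq_iUnion] at hu
  obtain ⟨t, ht⟩ := IsCompact.elim_finite_subcover u.hasCompactSupport _ (fun i => i.2.2) hu
  obtain ⟨p, hp⟩ := SmoothPartitionOfUnity.exists_isSubordinate 𝓘(ℝ, V)
    (isClosed_tsupport u) (fun i : t => (i.1 : Set V))
    (fun i => i.1.2.2) (by simpa [Set.iUnion_subtype] using ht)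
  have hsum : u = ∑ i : t, mulSmooth u (p i) (p i).contMDiff.contDiff := by
    ext x
    have : (∑ i : t, mulSmooth u (p i) (p i).contMDiff.contDiff) x
        = ∑ i : t, u x * p i x := by
      exact map_sum (AddMonoidHom.mk' (fun g : 𝓓((⊤ : Opens V), ℝ) => g x) fun _ _ => rfl) _ _
    rw [this, ← Finset.mul_sum]
    by_cases hx : x ∈ tsupport u
    · have h1 := p.sum_eq_one hx
      rw [finsum_eq_sum_of_fintype] at h1
      rw [h1, mul_one]
    · rw [image_eq_zero_of_notMem_tsupport hx, zero_mul]
  rw [hsum, map_sum]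
  refine Finset.sum_eq_zero fun i _ => i.1.2.1 _ ?_
  exact (closure_mono (Function.support_mul_subset_right _ _)).trans (hp i)

/-- The pairing does not depend on the cutoff function. -/
theorem pairing_eq [FiniteDimensional ℝ V] {T : 𝓓'((⊤ : Opens V), ℝ)} {f : V → ℝ}
    (hT : IsCompact (dsupport T)) (hf : ContDiff ℝ ∞ f)
    (χ : 𝓓((⊤ : Opens V), ℝ)) (hχ : ∀ᶠ x in 𝓝ˢ (dsupport T), χ x = 1) :
    pairing T f = T (mulSmooth χ f hf) := by
  have h : IsCompact (dsupport T) ∧ ContDiff ℝ ∞ f := ⟨hT, hf⟩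
  rw [pairing, dif_pos h, ← sub_eq_zero, ← map_sub]
  apply apply_eq_zero
  intro x hx hxT
  have h1 := (eventually_nhdsSet_iff_forall.1 hχ) x hxT
  have h2 := (eventually_nhdsSet_iff_forall.1 (exists_cutoff h.1).choose_spec) x hxT
  refine notMem_tsupport_iff_eventuallyEq.2 ?_ hx
  filter_upwards [h1, h2] with y hy1 hy2
  simp [mulSmooth, hy1, hy2]

end Pairing

/-! ### The scalar Riesz kernels, their potentials, and the capacities -/

section Capacity

variable {n : ℕ}

/-- The `i`-th component `xᵢ / |x|^(1+α)` of the `α`-Riesz kernel in `ℝⁿ`. -/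
noncomputable def kernel (α : ℝ) (i : Fin n) (x : EuclideanSpace ℝ (Fin n)) : ℝ :=
  x i / ‖x‖ ^ (1 + α)

/-- The kernel is locally integrable, hence a distribution, for `α < n`. -/
theorem kernel_locallyIntegrable {α : ℝ} (hα : α < n) (i : Fin n) :
    LocallyIntegrable (kernel α i) := by
  have hn : 1 ≤ n := by have := i.2; omega
  refine locallyIntegrable_of_norm_le_rpow (C := 1) (α := α) (by simpa using hn)
    (by simpa using hα) (Eventually.of_forall fun x => ?_) ?_
  · rcases eq_or_ne x 0 with rfl | hx
    · simp only [kernel, PiLp.zero_apply, zero_div, norm_zero, one_mul]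
      positivity
    · have hx' : 0 < ‖x‖ := norm_pos_iff.2 hx
      rw [kernel, norm_div, Real.norm_of_nonneg (Real.rpow_nonneg hx'.le _),
        Real.rpow_add hx', Real.rpow_one, Real.rpow_neg hx'.le, one_mul, div_le_iff₀ (by positivity)]
      have := PiLp.norm_apply_le x i
      field_simp
      exact this
  · have h1 : Measurable fun x : EuclideanSpace ℝ (Fin n) => x i := by fun_prop
    exact (h1.div (measurable_norm.pow_const (1 + α))).aestronglyMeasurable

/-- The function `k * φ`, the convolution of the `i`-th scalar `α`-Riesz kernel `k` with `φ`. -/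
noncomputable def kernelConv (α : ℝ) (i : Fin n) (φ : EuclideanSpace ℝ (Fin n) → ℝ) :
    EuclideanSpace ℝ (Fin n) → ℝ :=
  kernel α i ⋆[ContinuousLinearMap.mul ℝ ℝ, volume] φ

theorem kernelConv_contDiff {α : ℝ} (hα : α < n) (i : Fin n)
    (φ : 𝓓((⊤ : Opens (EuclideanSpace ℝ (Fin n))), ℝ)) : ContDiff ℝ ∞ (kernelConv α i φ) :=
  φ.hasCompactSupport.contDiff_convolution_right _ (kernel_locallyIntegrable hα i) φ.contDiff

/-- The potential `k * T` of a compactly supported distribution `T`, which acts on a test function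
`φ` by `⟨k * T, φ⟩ = ⟨T, k * φ⟩`. (The kernel is odd: reflecting it here would only change the sign
of the potential, not its norm.) -/
noncomputable def potential (α : ℝ) (i : Fin n) (T : 𝓓'((⊤ : Opens (EuclideanSpace ℝ (Fin n))), ℝ))
    (φ : 𝓓((⊤ : Opens (EuclideanSpace ℝ (Fin n))), ℝ)) : ℝ :=
  pairing T (kernelConv α i φ)

/-- A functional on test functions lies in the closed unit ball of `L^∞(ℝⁿ)`: it is the integration
against a measurable function whose essential supremum norm is at most one. -/
def InUnitBallLinfty (S : 𝓓((⊤ : Opens (EuclideanSpace ℝ (Fin n))), ℝ) → ℝ) : Prop :=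
  ∃ b : EuclideanSpace ℝ (Fin n) → ℝ, AEStronglyMeasurable b volume ∧ eLpNorm b ∞ volume ≤ 1 ∧
    ∀ φ : 𝓓((⊤ : Opens (EuclideanSpace ℝ (Fin n))), ℝ), S φ = ∫ x, b x * φ x

/-- The capacity `κ_{α,i}(E)` of a compact set `E` associated with the `i`-th scalar `α`-Riesz
potential: the supremum of `|⟨T, 1⟩|` over all real distributions `T` supported on `E` such that
the potential `xᵢ / |x|^(1+α) * T` lies in the unit ball of `L^∞(ℝⁿ)`. -/
noncomputable def kappa (α : ℝ) (i : Fin n) (E : Set (EuclideanSpace ℝ (Fin n))) : ℝ≥0∞ :=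
  ⨆ (T : 𝓓'((⊤ : Opens (EuclideanSpace ℝ (Fin n))), ℝ)) (_ : dsupport T ⊆ E)
    (_ : InUnitBallLinfty (potential α i T)), ENNReal.ofReal |pairing T (fun _ => 1)|

end Capacity

end ScalarRiesz

/-! The proof is by duality. Write `k` for the kernel. Suppose that test functions `g N`, bounded in
`L^1` by `B`, have potentials `k * g N` converging, uniformly with all derivatives, to a smooth `φ`
equal to one on the unit ball (`exists_approximate_preimage`). If the support of `T` lies in a ball
of radius `l`, rescale: `⟨T, 1⟩ = ⟨T, φ((x - x₀)/l)⟩ = lim ⟨T, k * u N⟩ = lim ⟨k * T, u N⟩`, where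
`u N` is a dilate of `g N` with `L^1` norm at most `B l^α`. Since `k * T` lies in the unit ball of
`L^∞`, `|⟨T, 1⟩| ≤ B l^α` (`abs_pairing_one_le`), and `l` decreases to the diameter.

To find the `g N`, note that the Fourier transform of `k` is an imaginary constant times `ξᵢ
|ξ|^(-β)` with `β = n + 1 - α` (`integral_kernel_mul_eq_fourierInv`, by writing powers as
superpositions of Gaussians). Hence, up to a constant, `k * (-Δ)^(β/2) ψ = ∂ᵢψ`, and the choice `ψ =
xᵢ χ` with a cutoff `χ` makes the right side equal to one on the unit ball.

The function `(-Δ)^(β/2) ψ` is not compactly supported in general. It is therefore written as a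
hypersingular integral of centred differences of order `2n` against `|y|^(-n-β)`, with the steps `y`
truncated to an annulus. The truncations are test functions; they are bounded in `L^1` uniformly in
the annulus (`exists_integral_norm_truncDiff_le`); and their symbols increase to a multiple of
`|ξ|^β` (`tendsto_truncSymbol`, `totalSymbol_eq`). Dominated convergence on the Fourier side,
against the decay of a Schwartz function, makes the error tend to zero with all its derivatives. -/

namespace ScalarRiesz

open scoped FourierTransform RealInnerProductSpace SchwartzMap LineDeriv

/-! ### Continuity of the pairing of a distribution with smooth functions. -/

section PairingLimits

variable {V : Type*} [NormedAddCommGroup V] [NormedSpace ℝ V]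

theorem isCompact_dsupport_of_subset [FiniteDimensional ℝ V] {T : 𝓓'((⊤ : Opens V), ℝ)}
    {E : Set V} (hE : IsCompact E) (hT : dsupport T ⊆ E) : IsCompact (dsupport T) :=
  hE.of_isClosed_subset isClosed_dsupport hT

/-- The pairing only depends on the values of the function near the support. -/
theorem pairing_congr [FiniteDimensional ℝ V] {T : 𝓓'((⊤ : Opens V), ℝ)} {f g : V → ℝ}
    (hT : IsCompact (dsupport T)) (hf : ContDiff ℝ ∞ f) (hg : ContDiff ℝ ∞ g)
    (hfg : ∀ᶠ x in 𝓝ˢ (dsupport T), f x = g x) : pairing T f = pairing T g := by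
  obtain ⟨χ, hχ⟩ := exists_cutoff hT
  rw [pairing_eq hT hf χ hχ, pairing_eq hT hg χ hχ, ← sub_eq_zero, ← map_sub]
  apply apply_eq_zero
  intro x hx hxT
  refine notMem_tsupport_iff_eventuallyEq.2 ?_ hx
  filter_upwards [(eventually_nhdsSet_iff_forall.1 hfg) x hxT] with y hy
  simp [mulSmooth, hy]

/-- A sequence of test functions supported in a fixed compact set all of whose derivatives tend to
zero uniformly tends to zero in the space of test functions. -/
theorem tendsto_testFunction_zero {Ω : Opens V} {K : Compacts V} (hK : (K : Set V) ⊆ Ω)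
    (u : ℕ → 𝓓(Ω, ℝ)) (hu : ∀ N, tsupport (u N) ⊆ K) (δ : ℕ → ℕ → ℝ)
    (hδ : ∀ j, Tendsto (δ j) atTop (𝓝 0))
    (h : ∀ j N x, ‖iteratedFDeriv ℝ j (u N) x‖ ≤ δ j N) : Tendsto u atTop (𝓝 0) := by
  -- With the support fixed in `K`, the topology is given by the sup norms of the derivatives, and
  -- the inclusion into all test functions is continuous.
  let v : ℕ → 𝓓_{K}(V, ℝ) := fun N =>
    ⟨u N, (u N).contDiff, fun x hx => image_eq_zero_of_notMem_tsupport fun hx' => hx (hu N hx')⟩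
  have hv : Tendsto v atTop (𝓝 0) := by
    rw [(ContDiffMapSupportedIn.withSeminorms ℝ V ℝ ⊤ K).tendsto_nhds]
    intro j ε hε
    filter_upwards [(hδ j).eventually_lt_const hε] with N hN
    rw [sub_zero]
    refine lt_of_le_of_lt ?_ hN
    rw [ContDiffMapSupportedIn.seminorm_top_le_iff ℝ ((norm_nonneg _).trans (h j N 0))]
    exact fun x _ => h j N x
  have h2 := ((TestFunction.continuous_ofSupportedIn (F := ℝ) (n := ⊤) hK).tendsto 0).comp hv
  have h3 : TestFunction.ofSupportedIn (F := ℝ) (n := ⊤) hK 0 = 0 := by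
    ext x; rfl
  rw [h3] at h2
  exact h2

/-- Uniform convergence of all derivatives implies the convergence of the pairings. -/
theorem tendsto_pairing [FiniteDimensional ℝ V] {T : 𝓓'((⊤ : Opens V), ℝ)}
    (hT : IsCompact (dsupport T)) {f : ℕ → V → ℝ} {g : V → ℝ} (hf : ∀ N, ContDiff ℝ ∞ (f N))
    (hg : ContDiff ℝ ∞ g) (δ : ℕ → ℕ → ℝ) (hδ : ∀ j, Tendsto (δ j) atTop (𝓝 0))
    (h : ∀ j N x, ‖iteratedFDeriv ℝ j (fun x => f N x - g x) x‖ ≤ δ j N) :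
    Tendsto (fun N => pairing T (f N)) atTop (𝓝 (pairing T g)) := by
  obtain ⟨χ, hχ⟩ := exists_cutoff hT
  have hbd : ∀ j, ∃ C, ∀ x, ‖iteratedFDeriv ℝ j χ x‖ ≤ C := fun j =>
    (χ.hasCompactSupport.iteratedFDeriv j).exists_bound_of_continuous
      (χ.contDiff.continuous_iteratedFDeriv (mod_cast le_top))
  choose C hC using hbd
  -- The cutoff differences all live in the support of `χ`; the Leibniz rule bounds their
  -- derivatives by those of `f N - g`.
  let u : ℕ → 𝓓((⊤ : Opens V), ℝ) := fun N => mulSmooth χ (fun x => f N x - g x) ((hf N).sub hg)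
  have hu : Tendsto u atTop (𝓝 0) := by
    refine tendsto_testFunction_zero (K := ⟨tsupport χ, χ.hasCompactSupport⟩) (by simp) u
      (fun N => closure_mono (Function.support_mul_subset_left _ _))
      (fun j N => ∑ p ∈ Finset.range (j + 1), (j.choose p : ℝ) * C p * δ (j - p) N) ?_ ?_
    · intro j
      rw [show (0 : ℝ) = ∑ p ∈ Finset.range (j + 1), (j.choose p : ℝ) * C p * 0 by simp]
      exact tendsto_finsetSum _ fun p _ => (hδ (j - p)).const_mul _
    · intro j N x
      refine (norm_iteratedFDeriv_mul_le (N := ∞) χ.contDiff ((hf N).sub hg) x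
        (mod_cast le_top)).trans ?_
      gcongr with p hp
      · exact mul_nonneg (Nat.cast_nonneg _) ((norm_nonneg _).trans (hC p x))
      · exact hC p x
      · exact h (j - p) N x
  have h1 : ∀ N, pairing T (f N) = T (u N) + pairing T g := by
    intro N
    rw [pairing_eq hT (hf N) χ hχ, pairing_eq hT hg χ hχ, ← map_add]
    congr 1
    ext x
    change χ x * f N x = χ x * (f N x - g x) + χ x * g x
    ring
  simp_rw [h1]
  have h2 : Tendsto (fun N => T (u N)) atTop (𝓝 (T 0)) := (T.continuous.tendsto 0).comp hu
  have h0 : T 0 = 0 := map_zero T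
  rw [h0] at h2
  simpa using h2.add_const (pairing T g)

end PairingLimits

/-! ### Fubini for a nonnegative kernel times a function of one variable. -/

/-- As `p ≥ 0`, integrating `|p h|` in `y` gives exactly `|(∫ p) h|`, so no absolute integrability
is lost by assuming only that `(∫ p) h` is integrable. -/
theorem integrable_mul_uncurry {X Y : Type*} [MeasurableSpace X] [MeasurableSpace Y]
    {μ : Measure X} {ν : Measure Y} [SFinite μ] [SFinite ν] {p : X → Y → ℝ}
    (hp : AEStronglyMeasurable (Function.uncurry p) (μ.prod ν)) (hp0 : ∀ x, ∀ᵐ y ∂ν, 0 ≤ p x y)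
    (hpi : ∀ᵐ x ∂μ, Integrable (p x) ν) {h : X → ℂ} (hh : AEStronglyMeasurable h μ)
    (hi : Integrable (fun x => ((∫ y, p x y ∂ν : ℝ) : ℂ) * h x) μ) :
    Integrable (fun z : X × Y => (p z.1 z.2 : ℂ) * h z.1) (μ.prod ν) := by
  have hm : AEStronglyMeasurable (fun z : X × Y => (p z.1 z.2 : ℂ) * h z.1) (μ.prod ν) :=
    (Complex.continuous_ofReal.comp_aestronglyMeasurable hp).mul hh.comp_fst
  refine (integrable_prod_iff hm).2 ⟨?_, ?_⟩
  · filter_upwards [hpi] with x hx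
    exact hx.ofReal.mul_const _
  · refine hi.norm.congr (Eventually.of_forall fun x => ?_)
    have h1 : ∀ᵐ y ∂ν, ‖(p x y : ℂ) * h x‖ = p x y * ‖h x‖ := by
      filter_upwards [hp0 x] with y hy
      rw [norm_mul, Complex.norm_real, Real.norm_of_nonneg hy]
    simp only
    rw [integral_congr_ae h1, integral_mul_const, norm_mul, Complex.norm_real,
      Real.norm_of_nonneg (integral_nonneg_of_ae (hp0 x))]

/-- Fubini's theorem for the product of a nonnegative kernel and a function of one variable. -/
theorem integral_integral_mul_swap {X Y : Type*} [MeasurableSpace X] [MeasurableSpace Y]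
    {μ : Measure X} {ν : Measure Y} [SFinite μ] [SFinite ν] {p : X → Y → ℝ}
    (hp : AEStronglyMeasurable (Function.uncurry p) (μ.prod ν)) (hp0 : ∀ x, ∀ᵐ y ∂ν, 0 ≤ p x y)
    (hpi : ∀ᵐ x ∂μ, Integrable (p x) ν) {h : X → ℂ} (hh : AEStronglyMeasurable h μ)
    (hi : Integrable (fun x => ((∫ y, p x y ∂ν : ℝ) : ℂ) * h x) μ) :
    ∫ x, ((∫ y, p x y ∂ν : ℝ) : ℂ) * h x ∂μ = ∫ y, ∫ x, (p x y : ℂ) * h x ∂μ ∂ν := by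
  rw [← integral_integral_swap (f := fun x y => (p x y : ℂ) * h x)
    (integrable_mul_uncurry hp hp0 hpi hh hi)]
  refine integral_congr_ae (Eventually.of_forall fun x => ?_)
  simp only
  rw [integral_mul_const, integral_complex_ofReal]

/-! ### Fourier transforms of Gaussians and of Gaussians times a coordinate. -/

section Gaussian

variable {n : ℕ}

theorem fourier_const_mul (c : ℂ) (f : EuclideanSpace ℝ (Fin n) → ℂ)
    (w : EuclideanSpace ℝ (Fin n)) : 𝓕 (fun v => c * f v) w = c * 𝓕 f w := by
  rw [Real.fourier_eq', Real.fourier_eq', ← integral_const_mul]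
  refine integral_congr_ae (Eventually.of_forall fun v => ?_)
  simp only [smul_eq_mul]
  ring

theorem fourierInv_const_mul (c : ℂ) (f : EuclideanSpace ℝ (Fin n) → ℂ)
    (w : EuclideanSpace ℝ (Fin n)) : 𝓕⁻ (fun v => c * f v) w = c * 𝓕⁻ f w := by
  rw [Real.fourierInv_eq', Real.fourierInv_eq', ← integral_const_mul]
  refine integral_congr_ae (Eventually.of_forall fun v => ?_)
  simp only [smul_eq_mul]
  ring

theorem fourier_gaussian_real {t : ℝ} (ht : 0 < t) (w : EuclideanSpace ℝ (Fin n)) :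
    𝓕 (fun v : EuclideanSpace ℝ (Fin n) => ((Real.exp (-(Real.pi * t * ‖v‖ ^ 2)) : ℝ) : ℂ)) w
      = ((t ^ (-(n / 2 : ℝ)) * Real.exp (-(Real.pi * t⁻¹ * ‖w‖ ^ 2)) : ℝ) : ℂ) := by
  have hb : 0 < ((Real.pi * t : ℝ) : ℂ).re := by
    rw [Complex.ofReal_re]; positivity
  have h := fourier_gaussian_innerProductSpace hb w
  have hpi : (Real.pi : ℂ) ≠ 0 := by exact_mod_cast Real.pi_ne_zero
  have ht' : (t : ℂ) ≠ 0 := by exact_mod_cast ht.ne'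
  convert h using 1
  · refine congrFun (congrArg 𝓕 (funext fun v => ?_)) w
    push_cast
    congr 1
    ring
  · rw [Real.rpow_neg ht.le, ← Real.inv_rpow ht.le]
    push_cast [Complex.ofReal_cpow (inv_nonneg.2 ht.le)]
    congr 2
    · field_simp
    · simp
    · field_simp

theorem integrable_gaussian {t : ℝ} (ht : 0 < t) :
    Integrable fun v : EuclideanSpace ℝ (Fin n) => Real.exp (-(Real.pi * t * ‖v‖ ^ 2)) := by
  have h := GaussianFourier.integrable_cexp_neg_mul_sq_norm_add (V := EuclideanSpace ℝ (Fin n))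
    (b := ((Real.pi * t : ℝ) : ℂ)) (by rw [Complex.ofReal_re]; positivity) 0 0
  refine h.re.congr (Eventually.of_forall fun v => ?_)
  simp only [zero_mul, add_zero]
  rw [show -((Real.pi * t : ℝ) : ℂ) * (‖v‖ : ℂ) ^ 2
    = ((-(Real.pi * t * ‖v‖ ^ 2) : ℝ) : ℂ) by push_cast; ring, ← Complex.ofReal_exp]
  exact Complex.ofReal_re _

/-- Half of the exponent absorbs the factor `‖v‖`, by `1 + s ≤ exp s`; the other half is still an
integrable Gaussian. -/
theorem integrable_norm_mul_gaussian {t : ℝ} (ht : 0 < t) :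
    Integrable fun v : EuclideanSpace ℝ (Fin n) =>
      ‖v‖ * Real.exp (-(Real.pi * t * ‖v‖ ^ 2)) := by
  have hc : 0 < Real.pi * (t / 2) := by positivity
  refine ((integrable_gaussian (n := n) (half_pos ht)).const_mul
    (1 + (Real.pi * (t / 2))⁻¹)).mono' (by fun_prop) (Eventually.of_forall fun v => ?_)
  rw [Real.norm_of_nonneg (by positivity),
    show -(Real.pi * t * ‖v‖ ^ 2) = -(Real.pi * (t / 2) * ‖v‖ ^ 2) + -(Real.pi * (t / 2) * ‖v‖ ^ 2)
      by ring, Real.exp_add, ← mul_assoc]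
  refine mul_le_mul_of_nonneg_right ?_ (Real.exp_nonneg _)
  rw [Real.exp_neg, ← div_eq_mul_inv, div_le_iff₀ (Real.exp_pos _)]
  have h1 := Real.add_one_le_exp (Real.pi * (t / 2) * ‖v‖ ^ 2)
  have h2 : (Real.pi * (t / 2))⁻¹ * (Real.pi * (t / 2) * ‖v‖ ^ 2) = ‖v‖ ^ 2 := by
    rw [← mul_assoc, inv_mul_cancel₀ hc.ne', one_mul]
  have h3 : 0 < (Real.pi * (t / 2))⁻¹ := inv_pos.2 hc
  calc ‖v‖ ≤ 1 * 1 + ‖v‖ ^ 2 := by nlinarith [sq_nonneg (‖v‖ - 1), norm_nonneg v]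
    _ ≤ (1 + (Real.pi * (t / 2))⁻¹) * (Real.pi * (t / 2) * ‖v‖ ^ 2 + 1) := by
      nlinarith [mul_nonneg hc.le (sq_nonneg ‖v‖)]
    _ ≤ _ := mul_le_mul_of_nonneg_left h1 (by positivity)

/-- Differentiate the transform of the Gaussian in direction `i` in two ways: under the integral,
which brings down `-2πi vᵢ`, and in closed form, which brings down `-2π wᵢ / t`. -/
theorem fourier_coord_mul_gaussian {t : ℝ} (ht : 0 < t) (i : Fin n)
    (w : EuclideanSpace ℝ (Fin n)) :
    𝓕 (fun v : EuclideanSpace ℝ (Fin n) =>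
        ((v i * Real.exp (-(Real.pi * t * ‖v‖ ^ 2)) : ℝ) : ℂ)) w
      = -Complex.I * ((t ^ (-(n / 2 + 1 : ℝ)) * Real.exp (-(Real.pi * t⁻¹ * ‖w‖ ^ 2)) : ℝ) : ℂ)
        * (w i : ℂ) := by
  set G : EuclideanSpace ℝ (Fin n) → ℂ :=
    fun v => ((Real.exp (-(Real.pi * t * ‖v‖ ^ 2)) : ℝ) : ℂ) with hG
  have hGi : Integrable G := (integrable_gaussian ht).ofReal
  have hGi' : Integrable fun v => ‖v‖ * ‖G v‖ := by
    refine (integrable_norm_mul_gaussian (n := n) ht).congr (Eventually.of_forall fun v => ?_)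
    simp only [hG]
    rw [Complex.norm_real, Real.norm_of_nonneg (Real.exp_nonneg _)]
  have h1 := Real.hasFDerivAt_fourier hGi hGi' w
  have h2 := (((hasStrictFDerivAt_norm_sq w).hasFDerivAt.const_mul
    (Real.pi * t⁻¹)).neg.exp).const_mul (t ^ (-(n / 2 : ℝ)))
  have h3 : 𝓕 G = fun w => ((t ^ (-(n / 2 : ℝ)) * Real.exp (-(Real.pi * t⁻¹ * ‖w‖ ^ 2)) : ℝ) : ℂ) :=
    funext fun w => fourier_gaussian_real ht w
  rw [h3] at h1
  have h4 := h1.unique (Complex.ofRealCLM.hasFDerivAt.comp w h2)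
  have h5 := DFunLike.congr_fun h4 (EuclideanSpace.single i (1 : ℝ))
  have h6 : Integrable (VectorFourier.fourierSMulRight (innerSL ℝ) G) := by
    refine (hGi'.const_mul (2 * Real.pi * ‖innerSL (E := EuclideanSpace ℝ (Fin n)) ℝ‖)).mono'
      hGi.aestronglyMeasurable.fourierSMulRight (Eventually.of_forall fun v => ?_)
    rw [← mul_assoc]
    exact VectorFourier.norm_fourierSMulRight_le _ _ _
  rw [Real.fourier_continuousLinearMap_apply h6] at h5
  have h7 : (fun x => VectorFourier.fourierSMulRight (innerSL ℝ) G x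
      (EuclideanSpace.single i (1 : ℝ))) = fun v => (-(2 * Real.pi * Complex.I)) *
        ((v i * Real.exp (-(Real.pi * t * ‖v‖ ^ 2)) : ℝ) : ℂ) := by
    funext v
    rw [VectorFourier.fourierSMulRight_apply, innerSL_apply_apply,
      EuclideanSpace.inner_single_right]
    simp [hG, mul_assoc]
  rw [h7, fourier_const_mul] at h5
  have hpi : (Real.pi : ℂ) ≠ 0 := by exact_mod_cast Real.pi_ne_zero
  have hc : -(2 * Real.pi * Complex.I) ≠ 0 := by simp [Real.pi_ne_zero]
  apply mul_left_cancel₀ hc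
  rw [h5, neg_add, Real.rpow_add ht, Real.rpow_neg_one]
  simp [EuclideanSpace.inner_single_right]
  ring_nf
  simp

end Gaussian

/-! ### Gamma integrals, used to write powers as superpositions of Gaussians. -/

section GammaIntegrals

open Set

theorem integrableOn_rpow_mul_exp_neg_mul {a r : ℝ} (ha : 0 < a) (hr : 0 < r) :
    IntegrableOn (fun t : ℝ => t ^ (a - 1) * Real.exp (-(r * t))) (Ioi 0) := by
  have h := integrableOn_rpow_mul_exp_neg_mul_rpow (p := 1) (s := a - 1) (b := r) (by linarith)
    one_pos hr
  simpa using h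

theorem integrableOn_rpow_mul_exp_neg_mul_inv {b r : ℝ} (hb : 0 < b) (hr : 0 < r) :
    IntegrableOn (fun t : ℝ => t ^ (-b - 1) * Real.exp (-(r * t⁻¹))) (Ioi 0) := by
  refine ((integrableOn_Ioi_comp_rpow_iff _ (p := -1) (by norm_num)).2
    (integrableOn_rpow_mul_exp_neg_mul hb hr)).congr_fun (fun t ht => ?_) measurableSet_Ioi
  have ht' : (0 : ℝ) < t := ht
  simp only [smul_eq_mul]
  rw [abs_neg, abs_one, one_mul, Real.rpow_neg_one, Real.inv_rpow ht'.le, ← Real.rpow_neg ht'.le,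
    ← mul_assoc, ← Real.rpow_add ht']
  congr 2
  ring

/-- The substitution `t ↦ 1/t` turns this into the Gamma integral. It is needed because the Fourier
transform inverts the width of a Gaussian. -/
theorem integral_rpow_mul_exp_neg_mul_inv {b r : ℝ} (hb : 0 < b) (hr : 0 < r) :
    ∫ t in Ioi (0 : ℝ), t ^ (-b - 1) * Real.exp (-(r * t⁻¹)) = (1 / r) ^ b * Real.Gamma b := by
  rw [← Real.integral_rpow_mul_exp_neg_mul_Ioi hb hr,
    ← integral_comp_rpow_Ioi _ (p := -1) (by norm_num)]
  refine setIntegral_congr_fun measurableSet_Ioi fun t ht => ?_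
  have ht' : (0 : ℝ) < t := ht
  simp only [smul_eq_mul]
  rw [abs_neg, abs_one, one_mul, Real.rpow_neg_one, Real.inv_rpow ht'.le, ← Real.rpow_neg ht'.le,
    ← mul_assoc, ← Real.rpow_add ht', inv_inv]
  congr 2
  ring

end GammaIntegrals

/-! ### The Fourier transform of the scalar Riesz kernel. -/

section KernelFourier

variable {n : ℕ}

/-- On the unit ball `g` is bounded and `γ < n` makes the singularity integrable; outside, the power
is at most one and `g` is integrable. -/
theorem integrable_norm_rpow_mul (hn : 1 ≤ n) {γ : ℝ} (hγ0 : 0 ≤ γ) (hγ : γ < n)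
    {g : EuclideanSpace ℝ (Fin n) → ℂ} (hg : Integrable g) {M : ℝ} (hM : ∀ x, ‖g x‖ ≤ M) :
    Integrable fun x => ((‖x‖ ^ (-γ) : ℝ) : ℂ) * g x := by
  have hm : AEStronglyMeasurable (fun x => ((‖x‖ ^ (-γ) : ℝ) : ℂ) * g x) volume :=
    (Complex.measurable_ofReal.comp
      (measurable_norm.pow_const (-γ))).aestronglyMeasurable.mul hg.aestronglyMeasurable
  have hnorm : ∀ x : EuclideanSpace ℝ (Fin n),
      ‖((‖x‖ ^ (-γ) : ℝ) : ℂ) * g x‖ = ‖x‖ ^ (-γ) * ‖g x‖ := fun x => by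
    rw [norm_mul, Complex.norm_real, Real.norm_of_nonneg (Real.rpow_nonneg (norm_nonneg _) _)]
  have h1 : IntegrableOn (fun x => ((‖x‖ ^ (-γ) : ℝ) : ℂ) * g x) (Metric.ball 0 1) := by
    refine integrableOn_ball_of_norm_le_rpow (C := M) (α := γ) (by simpa using hn)
      (by simpa using hγ) (Eventually.of_forall fun x => ?_) hm
    rw [hnorm, mul_comm M]
    exact mul_le_mul_of_nonneg_left (hM x) (Real.rpow_nonneg (norm_nonneg _) _)
  have h2 : IntegrableOn (fun x => ((‖x‖ ^ (-γ) : ℝ) : ℂ) * g x) (Metric.ball 0 1)ᶜ := by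
    refine hg.norm.integrableOn.mono' hm.restrict ?_
    filter_upwards [ae_restrict_mem Metric.isOpen_ball.measurableSet.compl] with x hx
    rw [hnorm]
    refine mul_le_of_le_one_left (norm_nonneg _) (Real.rpow_le_one_of_one_le_of_nonpos ?_ ?_)
    · simpa using hx
    · linarith
  simpa using h1.union h2

/-- The convolution of an integrable function with a Schwartz function is the inverse Fourier
transform of the product of the Fourier transforms. -/
theorem integral_mul_sub_eq_fourierInv {G : EuclideanSpace ℝ (Fin n) → ℂ} (hG : Integrable G)
    (f : 𝓢(EuclideanSpace ℝ (Fin n), ℂ)) (x : EuclideanSpace ℝ (Fin n)) :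
    ∫ z, G z * f (x - z) = 𝓕⁻ (fun ξ => 𝓕 G ξ * (𝓕 f) ξ) x := by
  -- The modulated transform is chosen so that its own transform is `z ↦ f (x - z)`; the formula `∫
  -- 𝓕G · g = ∫ G · 𝓕g` then gives the claim.
  set g : EuclideanSpace ℝ (Fin n) → ℂ := fun ξ => Real.fourierChar ⟪ξ, x⟫ • (𝓕 f) ξ with hg
  have hgi : Integrable g := by
    refine (𝓕 f).integrable.norm.mono' ?_ (Eventually.of_forall fun ξ => ?_)
    · refine Continuous.aestronglyMeasurable ?_
      exact (Real.continuous_fourierChar.comp (by fun_prop)).smul (𝓕 f).continuous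
    · rw [hg, Circle.norm_smul]
  have h1 : ∀ z, 𝓕 g z = f (x - z) := by
    intro z
    have h2 : 𝓕⁻ (𝓕 f) (x - z) = f (x - z) := by
      rw [FourierTransform.fourierInv_fourier_eq]
    rw [← h2, SchwartzMap.fourierInv_coe, Real.fourierInv_eq, Real.fourier_eq]
    refine integral_congr_ae (Eventually.of_forall fun ξ => ?_)
    simp only [hg]
    rw [← mul_smul, ← AddChar.map_add_eq_mul, inner_sub_right]
    congr 2
    ring
  have h3 := VectorFourier.integral_fourierIntegral_smul_eq_flip (L := innerₗ _)
    Real.continuous_fourierChar continuous_inner hG hgi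
  rw [flip_innerₗ] at h3
  rw [Real.fourierInv_eq]
  calc ∫ z, G z * f (x - z) = ∫ z, G z • 𝓕 g z := by simp_rw [h1, smul_eq_mul]
    _ = ∫ ξ, 𝓕 G ξ • g ξ := h3.symm
    _ = _ := by
      refine integral_congr_ae (Eventually.of_forall fun ξ => ?_)
      simp only [hg, smul_eq_mul, Circle.smul_def]
      ring

theorem kernel_eq (α : ℝ) (i : Fin n) (z : EuclideanSpace ℝ (Fin n)) :
    kernel α i z = z i * ‖z‖ ^ (-(1 + α)) := by
  rw [kernel, Real.rpow_neg (norm_nonneg _), div_eq_mul_inv]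

theorem norm_coord_mul_rpow_le (γ : ℝ) (i : Fin n) (z : EuclideanSpace ℝ (Fin n)) :
    |z i * ‖z‖ ^ (-(1 + γ))| ≤ ‖z‖ ^ (-γ) := by
  rcases eq_or_ne z 0 with rfl | hz
  · simp [Real.rpow_nonneg]
  · have hz' : 0 < ‖z‖ := norm_pos_iff.2 hz
    rw [abs_mul, abs_of_nonneg (Real.rpow_nonneg hz'.le _)]
    have h : ‖z‖ ^ (-γ) = ‖z‖ * ‖z‖ ^ (-(1 + γ)) := by
      rw [show -γ = 1 + -(1 + γ) by ring, Real.rpow_add hz', Real.rpow_one]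
    rw [h]
    exact mul_le_mul_of_nonneg_right (PiLp.norm_apply_le z i) (Real.rpow_nonneg hz'.le _)

theorem one_div_pi_mul_sq_rpow {r : ℝ} (hr : 0 < r) (a : ℝ) :
    (1 / (Real.pi * r ^ 2)) ^ a = (1 / Real.pi) ^ a * r ^ (-(2 * a)) := by
  rw [one_div, mul_inv, Real.mul_rpow (by positivity) (by positivity), one_div,
    ← Real.rpow_natCast r 2, ← Real.rpow_neg hr.le, ← Real.rpow_mul hr.le]
  congr 2
  push_cast
  ring

/-- Serves both sides of the transform: `γ = α` for the kernel and `γ = n - α` for its symbol. -/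
theorem integrable_coord_mul_rpow_mul (hn : 1 ≤ n) {γ : ℝ} (hγ0 : 0 ≤ γ) (hγ : γ < n) (i : Fin n)
    {g : EuclideanSpace ℝ (Fin n) → ℂ} (hg : Integrable g) {M : ℝ} (hM : ∀ x, ‖g x‖ ≤ M) :
    Integrable fun x => ((x i * ‖x‖ ^ (-(1 + γ)) : ℝ) : ℂ) * g x := by
  refine (integrable_norm_rpow_mul hn hγ0 hγ hg hM).mono ?_ (Eventually.of_forall fun x => ?_)
  · refine (Complex.measurable_ofReal.comp (Measurable.mul ?_
      (measurable_norm.pow_const _))).aestronglyMeasurable.mul hg.aestronglyMeasurable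
    fun_prop
  · rw [norm_mul, norm_mul, Complex.norm_real, Complex.norm_real,
      Real.norm_of_nonneg (Real.rpow_nonneg (norm_nonneg _) _)]
    exact mul_le_mul_of_nonneg_right (norm_coord_mul_rpow_le γ i x) (norm_nonneg _)

/-- The Fourier transform of the scalar Riesz kernel, tested against a Schwartz function. -/
theorem integral_kernel_mul_eq_fourierInv {α : ℝ} (hα0 : 0 < α) (hαn : α < n) (i : Fin n)
    (f : 𝓢(EuclideanSpace ℝ (Fin n), ℂ)) (x : EuclideanSpace ℝ (Fin n)) :
    (((1 / Real.pi) ^ ((1 + α) / 2) * Real.Gamma ((1 + α) / 2) : ℝ) : ℂ)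
        * ∫ z, (kernel α i z : ℂ) * f (x - z)
      = -Complex.I * (((1 / Real.pi) ^ ((n + 1 - α) / 2) * Real.Gamma ((n + 1 - α) / 2) : ℝ) : ℂ)
        * 𝓕⁻ (fun ξ : EuclideanSpace ℝ (Fin n) =>
            ((ξ i * ‖ξ‖ ^ (-(n + 1 - α)) : ℝ) : ℂ) * (𝓕 f) ξ) x := by
  have hn : 1 ≤ n := by have := i.2; omega
  have : Nontrivial (EuclideanSpace ℝ (Fin n)) :=
    Module.nontrivial_of_finrank_pos (R := ℝ) (by rw [finrank_euclideanSpace_fin]; omega)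
  set a : ℝ := (1 + α) / 2 with ha_def
  set b : ℝ := (n + 1 - α) / 2 with hb_def
  have ha : 0 < a := by positivity
  have hb : 0 < b := by rw [hb_def]; linarith
  have hfM : ∀ y, ‖f y‖ ≤ SchwartzMap.seminorm ℝ 0 0 f := fun y => f.norm_le_seminorm ℝ y
  have hFM : ∀ y, ‖(𝓕 f) y‖ ≤ SchwartzMap.seminorm ℝ 0 0 (𝓕 f) :=
    fun y => (𝓕 f).norm_le_seminorm ℝ y
  -- the Gaussian representation of the kernel
  let p : EuclideanSpace ℝ (Fin n) → ℝ → ℝ :=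
    fun z t => t ^ (a - 1) * Real.exp (-(Real.pi * ‖z‖ ^ 2 * t))
  let h : EuclideanSpace ℝ (Fin n) → ℂ := fun z => (z i : ℂ) * f (x - z)
  have hP : ∀ z, ((∫ t in Set.Ioi 0, p z t : ℝ) : ℂ) * h z
      = (((1 / Real.pi) ^ a * Real.Gamma a : ℝ) : ℂ) * ((kernel α i z : ℂ) * f (x - z)) := by
    intro z
    -- At the origin the Gamma formula does not apply, but the coordinate factor vanishes on both
    -- sides.
    rcases eq_or_ne z 0 with rfl | hz
    · simp [h, kernel]
    · have hz' : 0 < ‖z‖ := norm_pos_iff.2 hz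
      simp only [p]
      rw [Real.integral_rpow_mul_exp_neg_mul_Ioi ha (by positivity),
        one_div_pi_mul_sq_rpow hz', kernel_eq, show 2 * a = 1 + α by rw [ha_def]; ring]
      simp only [h]
      push_cast
      ring
  -- the Gaussian representation of its Fourier transform
  let q : EuclideanSpace ℝ (Fin n) → ℝ → ℝ :=
    fun ξ t => t ^ (-b - 1) * Real.exp (-(Real.pi * ‖ξ‖ ^ 2 * t⁻¹))
  let k : EuclideanSpace ℝ (Fin n) → ℂ := fun ξ => Real.fourierChar ⟪ξ, x⟫ • ((ξ i : ℂ) * (𝓕 f) ξ)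
  have hQ : ∀ ξ, ((∫ t in Set.Ioi 0, q ξ t : ℝ) : ℂ) * k ξ
      = (((1 / Real.pi) ^ b * Real.Gamma b : ℝ) : ℂ) * (Real.fourierChar ⟪ξ, x⟫ •
          (((ξ i * ‖ξ‖ ^ (-(n + 1 - α)) : ℝ) : ℂ) * (𝓕 f) ξ)) := by
    intro ξ
    rcases eq_or_ne ξ 0 with rfl | hξ
    · simp [k]
    · have hξ' : 0 < ‖ξ‖ := norm_pos_iff.2 hξ
      simp only [q]
      rw [integral_rpow_mul_exp_neg_mul_inv hb (by positivity),
        one_div_pi_mul_sq_rpow hξ', show 2 * b = n + 1 - α by rw [hb_def]; ring]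
      simp only [k, Circle.smul_def, smul_eq_mul]
      push_cast
      ring
  -- For fixed `t` this is the Gaussian identity; the powers of `t` match because `a + b = n/2 + 1`.
  -- Integrating in `t` and swapping on both sides then gives the theorem.
  have hpq : ∀ t ∈ Set.Ioi (0 : ℝ), ∫ z, (p z t : ℂ) * h z = -Complex.I * ∫ ξ, (q ξ t : ℂ) * k ξ := by
    intro t ht
    have ht' : 0 < t := ht
    have hG : Integrable fun v : EuclideanSpace ℝ (Fin n) =>
        ((v i * Real.exp (-(Real.pi * t * ‖v‖ ^ 2)) : ℝ) : ℂ) := by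
      have h0 : Integrable fun v : EuclideanSpace ℝ (Fin n) =>
          v i * Real.exp (-(Real.pi * t * ‖v‖ ^ 2)) := by
        refine (integrable_norm_mul_gaussian ht').mono' ?_ (Eventually.of_forall fun v => ?_)
        · exact Continuous.aestronglyMeasurable (by fun_prop)
        · rw [norm_mul, Real.norm_of_nonneg (Real.exp_nonneg _)]
          exact mul_le_mul_of_nonneg_right (PiLp.norm_apply_le v i) (Real.exp_nonneg _)
      exact h0.ofReal
    have h1 := integral_mul_sub_eq_fourierInv hG f x
    simp_rw [fourier_coord_mul_gaussian ht'] at h1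
    rw [Real.fourierInv_eq] at h1
    have h2 : ∀ z, (p z t : ℂ) * h z = ((t ^ (a - 1) : ℝ) : ℂ) *
        (((z i * Real.exp (-(Real.pi * t * ‖z‖ ^ 2)) : ℝ) : ℂ) * f (x - z)) := by
      intro z
      simp only [p, h]
      rw [show Real.pi * ‖z‖ ^ 2 * t = Real.pi * t * ‖z‖ ^ 2 by ring]
      push_cast
      ring
    simp_rw [h2]
    rw [integral_const_mul, h1, ← integral_const_mul, ← integral_const_mul]
    refine integral_congr_ae (Eventually.of_forall fun ξ => ?_)
    simp only [q, k, Circle.smul_def, smul_eq_mul]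
    rw [show -b - 1 = (a - 1) + -(n / 2 + 1 : ℝ) by rw [ha_def, hb_def]; ring, Real.rpow_add ht',
      show Real.pi * t⁻¹ * ‖ξ‖ ^ 2 = Real.pi * ‖ξ‖ ^ 2 * t⁻¹ by ring]
    push_cast
    ring
  have hkernel : Integrable fun z => (kernel α i z : ℂ) * f (x - z) := by
    simp_rw [kernel_eq]
    exact integrable_coord_mul_rpow_mul hn hα0.le hαn i (f.integrable.comp_sub_left x)
      fun y => hfM (x - y)
  have hchar : Continuous fun ξ : EuclideanSpace ℝ (Fin n) => Real.fourierChar ⟪ξ, x⟫ :=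
    Real.continuous_fourierChar.comp (by fun_prop)
  have hsymbol : Integrable fun ξ => Real.fourierChar ⟪ξ, x⟫ •
      (((ξ i * ‖ξ‖ ^ (-(n + 1 - α)) : ℝ) : ℂ) * (𝓕 f) ξ) := by
    have h3 := integrable_coord_mul_rpow_mul hn (γ := n - α) (by linarith) (by linarith) i
      (𝓕 f).integrable hFM
    rw [show 1 + (n - α) = n + 1 - α by ring] at h3
    refine h3.mono (hchar.aestronglyMeasurable.smul h3.aestronglyMeasurable)
      (Eventually.of_forall fun ξ => ?_)
    rw [Circle.norm_smul]
  calc _ = ∫ z, ((∫ t in Set.Ioi 0, p z t : ℝ) : ℂ) * h z := by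
        simp_rw [hP]
        rw [integral_const_mul]
    _ = ∫ t in Set.Ioi 0, ∫ z, (p z t : ℂ) * h z := by
        refine integral_integral_mul_swap ?_ ?_ ?_ ?_ ?_
        · refine Measurable.aestronglyMeasurable ?_
          exact (measurable_snd.pow_const _).mul (by fun_prop)
        · intro z
          filter_upwards [ae_restrict_mem measurableSet_Ioi] with t ht
          exact mul_nonneg (Real.rpow_nonneg (le_of_lt ht) _) (Real.exp_nonneg _)
        · filter_upwards [Measure.ae_ne volume 0] with z hz
          have hz' : 0 < ‖z‖ := norm_pos_iff.2 hz
          exact integrableOn_rpow_mul_exp_neg_mul ha (by positivity)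
        · refine Continuous.aestronglyMeasurable ?_
          have := f.continuous
          fun_prop
        · simp_rw [hP]
          exact hkernel.const_mul _
    _ = ∫ t in Set.Ioi 0, -Complex.I * ∫ ξ, (q ξ t : ℂ) * k ξ :=
        setIntegral_congr_fun measurableSet_Ioi hpq
    _ = -Complex.I * ∫ t in Set.Ioi 0, ∫ ξ, (q ξ t : ℂ) * k ξ := integral_const_mul _ _
    _ = -Complex.I * ∫ ξ, ((∫ t in Set.Ioi 0, q ξ t : ℝ) : ℂ) * k ξ := by
        congr 1
        refine (integral_integral_mul_swap ?_ ?_ ?_ ?_ ?_).symm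
        · refine Measurable.aestronglyMeasurable ?_
          exact (measurable_snd.pow_const _).mul (by fun_prop)
        · intro z
          filter_upwards [ae_restrict_mem measurableSet_Ioi] with t ht
          exact mul_nonneg (Real.rpow_nonneg (le_of_lt ht) _) (Real.exp_nonneg _)
        · filter_upwards [Measure.ae_ne volume 0] with z hz
          have hz' : 0 < ‖z‖ := norm_pos_iff.2 hz
          exact integrableOn_rpow_mul_exp_neg_mul_inv hb (by positivity)
        · refine Continuous.aestronglyMeasurable ?_
          have := (𝓕 f).continuous
          exact hchar.smul (by fun_prop)
        · simp_rw [hQ]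
          exact hsymbol.const_mul _
    _ = _ := by
        simp_rw [hQ]
        rw [integral_const_mul, Real.fourierInv_eq, mul_assoc]

end KernelFourier

/-! ### Symbols of centred differences, and their integral as a multiple of `|ξ|^β`. -/

section DifferenceSymbol

variable {n : ℕ}

/-- The Fourier symbol of the centred difference operator of order `2 m` with step `y`. -/
noncomputable def diffSymbol (m : ℕ) (y ξ : EuclideanSpace ℝ (Fin n)) : ℝ :=
  (2 - 2 * Real.cos (2 * Real.pi * ⟪y, ξ⟫)) ^ m

/-- The homogeneous weight `|y| ^ (-(n + β))`. -/
noncomputable def weight (β : ℝ) (y : EuclideanSpace ℝ (Fin n)) : ℝ :=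
  ‖y‖ ^ (-(n + β))

theorem weight_nonneg (β : ℝ) (y : EuclideanSpace ℝ (Fin n)) : 0 ≤ weight β y :=
  Real.rpow_nonneg (norm_nonneg _) _

theorem measurable_weight (β : ℝ) :
    Measurable (weight β : EuclideanSpace ℝ (Fin n) → ℝ) :=
  measurable_norm.pow_const _

theorem diffSymbol_nonneg (m : ℕ) (y ξ : EuclideanSpace ℝ (Fin n)) : 0 ≤ diffSymbol m y ξ :=
  pow_nonneg (by linarith [Real.cos_le_one (2 * Real.pi * ⟪y, ξ⟫)]) m

theorem diffSymbol_le (m : ℕ) (y ξ : EuclideanSpace ℝ (Fin n)) : diffSymbol m y ξ ≤ 4 ^ m :=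
  pow_le_pow_left₀ (by linarith [Real.cos_le_one (2 * Real.pi * ⟪y, ξ⟫)])
    (by linarith [Real.neg_one_le_cos (2 * Real.pi * ⟪y, ξ⟫)]) m

theorem diffSymbol_le_pow (m : ℕ) (y ξ : EuclideanSpace ℝ (Fin n)) :
    diffSymbol m y ξ ≤ (2 * Real.pi) ^ (2 * m) * ‖y‖ ^ (2 * m) * ‖ξ‖ ^ (2 * m) := by
  have h1 : 2 - 2 * Real.cos (2 * Real.pi * ⟪y, ξ⟫) ≤ (2 * Real.pi * ‖y‖ * ‖ξ‖) ^ 2 := by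
    have h2 := Real.one_sub_sq_div_two_le_cos (x := 2 * Real.pi * ⟪y, ξ⟫)
    have h3 : (2 * Real.pi * ⟪y, ξ⟫) ^ 2 ≤ (2 * Real.pi * ‖y‖ * ‖ξ‖) ^ 2 := by
      refine sq_le_sq.2 ?_
      rw [abs_mul, abs_of_pos Real.two_pi_pos,
        abs_of_nonneg (show 0 ≤ 2 * Real.pi * ‖y‖ * ‖ξ‖ by positivity), mul_assoc (2 * Real.pi)]
      exact mul_le_mul_of_nonneg_left (abs_real_inner_le_norm y ξ) Real.two_pi_pos.le
    linarith
  calc diffSymbol m y ξ ≤ ((2 * Real.pi * ‖y‖ * ‖ξ‖) ^ 2) ^ m :=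
        pow_le_pow_left₀ (by linarith [Real.cos_le_one (2 * Real.pi * ⟪y, ξ⟫)]) h1 m
    _ = _ := by rw [← pow_mul, mul_pow, mul_pow]

theorem continuous_diffSymbol (m : ℕ) : Continuous
    fun z : EuclideanSpace ℝ (Fin n) × EuclideanSpace ℝ (Fin n) => diffSymbol m z.1 z.2 := by
  unfold diffSymbol
  fun_prop

theorem continuous_diffSymbol_left (m : ℕ) (ξ : EuclideanSpace ℝ (Fin n)) :
    Continuous fun y => diffSymbol m y ξ := by
  unfold diffSymbol
  fun_prop

theorem continuous_diffSymbol_right (m : ℕ) (y : EuclideanSpace ℝ (Fin n)) :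
    Continuous fun ξ => diffSymbol m y ξ := by
  unfold diffSymbol
  fun_prop

/-- The condition `β < 2m` gives integrability at the origin, and `β > 0` gives it at infinity. This
function dominates both the symbols and the `L^1` norms of the differences, up to constants. -/
theorem integrable_weight_mul_min (hn : 1 ≤ n) {β : ℝ} (hβ : 0 < β) {m : ℕ} (hm : β < 2 * m) :
    Integrable fun y : EuclideanSpace ℝ (Fin n) => weight β y * min 1 (‖y‖ ^ (2 * m)) := by
  have hmeas : Measurable fun y : EuclideanSpace ℝ (Fin n) =>
      weight β y * min 1 (‖y‖ ^ (2 * m)) :=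
    (measurable_weight β).mul (by fun_prop)
  have hnonneg : ∀ y : EuclideanSpace ℝ (Fin n), 0 ≤ weight β y * min 1 (‖y‖ ^ (2 * m)) :=
    fun y => mul_nonneg (weight_nonneg β y) (by positivity)
  have h1 : IntegrableOn (fun y : EuclideanSpace ℝ (Fin n) =>
      weight β y * min 1 (‖y‖ ^ (2 * m))) (Metric.ball 0 1) := by
    refine integrableOn_ball_of_norm_le_rpow (C := 1) (α := n + β - 2 * m) (by simpa using hn)
      (by rw [finrank_euclideanSpace_fin]; linarith) (Eventually.of_forall fun y => ?_)
      hmeas.aestronglyMeasurable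
    rw [Real.norm_of_nonneg (hnonneg y), one_mul]
    rcases eq_or_ne y 0 with rfl | hy
    · have hm0 : m ≠ 0 := by
        rintro rfl
        simp at hm
        linarith
      simp only [norm_zero]
      rw [zero_pow (by omega), min_eq_right zero_le_one, mul_zero]
      exact Real.rpow_nonneg le_rfl _
    · have hy' : 0 < ‖y‖ := norm_pos_iff.2 hy
      refine (mul_le_mul_of_nonneg_left (min_le_right _ _) (weight_nonneg β y)).trans (le_of_eq ?_)
      rw [weight, ← Real.rpow_natCast, ← Real.rpow_add hy']
      congr 1
      push_cast
      ring
  have h2 : IntegrableOn (fun y : EuclideanSpace ℝ (Fin n) =>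
      weight β y * min 1 (‖y‖ ^ (2 * m))) (Metric.ball 0 1)ᶜ := by
    have h3 : Integrable fun y : EuclideanSpace ℝ (Fin n) => (1 + ‖y‖) ^ (-(n + β)) :=
      integrable_one_add_norm (by rw [finrank_euclideanSpace_fin]; linarith)
    refine (h3.const_mul (2 ^ (n + β))).integrableOn.mono' hmeas.aestronglyMeasurable.restrict ?_
    filter_upwards [ae_restrict_mem Metric.isOpen_ball.measurableSet.compl] with y hy
    have hy1 : 1 ≤ ‖y‖ := by simpa using hy
    rw [Real.norm_of_nonneg (hnonneg y)]
    refine (mul_le_of_le_one_right (weight_nonneg β y) (min_le_left _ _)).trans ?_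
    rw [weight, Real.rpow_neg (by linarith), Real.rpow_neg (by linarith), ← div_eq_mul_inv,
      le_div_iff₀ (by positivity), inv_mul_le_iff₀ (by positivity), ← Real.mul_rpow (by positivity)
      (by positivity)]
    exact Real.rpow_le_rpow (by positivity) (by linarith) (by positivity)
  simpa using h1.union h2

theorem integrable_weight_mul_diffSymbol (hn : 1 ≤ n) {β : ℝ} (hβ : 0 < β) {m : ℕ}
    (hm : β < 2 * m) (ξ : EuclideanSpace ℝ (Fin n)) :
    Integrable fun y => weight β y * diffSymbol m y ξ := by
  refine ((integrable_weight_mul_min hn hβ hm).const_mul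
    (4 ^ m + (2 * Real.pi) ^ (2 * m) * ‖ξ‖ ^ (2 * m))).mono' ?_ (Eventually.of_forall fun y => ?_)
  · refine ((measurable_weight β).mul ?_).aestronglyMeasurable
    exact (continuous_diffSymbol_left m ξ).measurable
  · rw [Real.norm_of_nonneg (mul_nonneg (weight_nonneg β y) (diffSymbol_nonneg m y ξ)),
      mul_left_comm]
    refine mul_le_mul_of_nonneg_left ?_ (weight_nonneg β y)
    rcases min_cases 1 (‖y‖ ^ (2 * m)) with ⟨h, -⟩ | ⟨h, -⟩ <;> rw [h]
    · have := diffSymbol_le m y ξ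
      have : 0 ≤ (2 * Real.pi) ^ (2 * m) * ‖ξ‖ ^ (2 * m) := by positivity
      linarith
    · have := diffSymbol_le_pow m y ξ
      have : 0 ≤ 4 ^ m * ‖y‖ ^ (2 * m) := by positivity
      linarith

/-- The integral of the symbols of the difference operators against the homogeneous weight. -/
noncomputable def totalSymbol (β : ℝ) (m : ℕ) (ξ : EuclideanSpace ℝ (Fin n)) : ℝ :=
  ∫ y, weight β y * diffSymbol m y ξ

theorem totalSymbol_comp_isometry (β : ℝ) (m : ℕ)
    (A : EuclideanSpace ℝ (Fin n) ≃ₗᵢ[ℝ] EuclideanSpace ℝ (Fin n))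
    (ξ : EuclideanSpace ℝ (Fin n)) : totalSymbol β m (A ξ) = totalSymbol β m ξ := by
  rw [totalSymbol, totalSymbol, ← A.measurePreserving.integral_comp
    A.toHomeomorph.measurableEmbedding]
  simp [weight, diffSymbol]

/-- The weight and Lebesgue measure are invariant under isometries, and a reflection exchanges two
vectors of the same norm. -/
theorem totalSymbol_eq_of_norm_eq (β : ℝ) (m : ℕ) {ξ η : EuclideanSpace ℝ (Fin n)}
    (h : ‖ξ‖ = ‖η‖) : totalSymbol β m ξ = totalSymbol β m η := by
  rw [← Submodule.reflection_sub h, totalSymbol_comp_isometry]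

/-- Substitute `r y` for `y`: the weight has degree `-(n + β)` and the volume contributes `n`. With
radial symmetry this forces a multiple of `|ξ|^β`. -/
theorem totalSymbol_smul (β : ℝ) (m : ℕ) {r : ℝ} (hr : 0 < r) (ξ : EuclideanSpace ℝ (Fin n)) :
    totalSymbol β m (r • ξ) = r ^ β * totalSymbol β m ξ := by
  have h1 := Measure.integral_comp_smul_of_nonneg volume
    (fun y : EuclideanSpace ℝ (Fin n) => weight β y * diffSymbol m y ξ) r (hR := hr.le)
  have h2 : ∀ y : EuclideanSpace ℝ (Fin n), weight β (r • y) * diffSymbol m (r • y) ξ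
      = r ^ (-(n + β)) * (weight β y * diffSymbol m y (r • ξ)) := by
    intro y
    rw [weight, weight, norm_smul, Real.norm_of_nonneg hr.le, Real.mul_rpow hr.le (norm_nonneg _),
      diffSymbol, diffSymbol, real_inner_smul_left, real_inner_smul_right]
    ring
  simp_rw [h2] at h1
  rw [integral_const_mul, finrank_euclideanSpace_fin, smul_eq_mul] at h1
  rw [totalSymbol, totalSymbol]
  have h3 : r ^ (n + β) * r ^ (-(n + β)) = 1 := by
    rw [← Real.rpow_add hr, add_neg_cancel, Real.rpow_zero]
  have h4 : r ^ (n + β) * (r ^ n)⁻¹ = r ^ β := by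
    rw [Real.rpow_add hr, Real.rpow_natCast]
    field_simp
  rw [← h4, mul_assoc, ← h1, ← mul_assoc, h3, one_mul]

theorem totalSymbol_eq {β : ℝ} (hβ : 0 < β) {m : ℕ} (hm : m ≠ 0)
    {e : EuclideanSpace ℝ (Fin n)} (he : ‖e‖ = 1) (ξ : EuclideanSpace ℝ (Fin n)) :
    totalSymbol β m ξ = totalSymbol β m e * ‖ξ‖ ^ β := by
  rcases eq_or_ne ξ 0 with rfl | hξ
  · rw [norm_zero, Real.zero_rpow hβ.ne', mul_zero, totalSymbol]
    simp [diffSymbol, hm]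
  · have hξ' : 0 < ‖ξ‖ := norm_pos_iff.2 hξ
    rw [mul_comm, ← totalSymbol_smul β m hξ']
    refine totalSymbol_eq_of_norm_eq β m ?_
    rw [norm_smul, he, norm_norm, mul_one]

theorem totalSymbol_pos (hn : 1 ≤ n) {β : ℝ} (hβ : 0 < β) {m : ℕ} (hm : β < 2 * m)
    {e : EuclideanSpace ℝ (Fin n)} (he : ‖e‖ = 1) : 0 < totalSymbol β m e := by
  rw [totalSymbol, integral_pos_iff_support_of_nonneg
    (fun y => mul_nonneg (weight_nonneg β y) (diffSymbol_nonneg m y e))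
    (integrable_weight_mul_diffSymbol hn hβ hm e)]
  have hU : IsOpen ({y : EuclideanSpace ℝ (Fin n) | 0 < ‖y‖} ∩ {y | 0 < diffSymbol m y e}) := by
    refine (isOpen_lt continuous_const continuous_norm).inter (isOpen_lt continuous_const ?_)
    exact continuous_diffSymbol_left m e
  -- At `y = e/2` the cosine is `-1`, so the symbol is `4^m`; by continuity it is positive on an
  -- open set.
  refine (hU.measure_pos volume ⟨(1 / 2 : ℝ) • e, ?_, ?_⟩).trans_le (measure_mono ?_)
  · change 0 < ‖(1 / 2 : ℝ) • e‖
    rw [norm_smul, he]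
    norm_num
  · change 0 < diffSymbol m ((1 / 2 : ℝ) • e) e
    rw [diffSymbol, real_inner_smul_left, real_inner_self_eq_norm_sq, he,
      show 2 * Real.pi * (1 / 2 * 1 ^ 2) = Real.pi by ring, Real.cos_pi]
    norm_num
  · rintro y ⟨hy1, hy2⟩
    exact (mul_pos (Real.rpow_pos_of_pos hy1 _) hy2).ne'

/-- The annulus over which the integrals over the steps are truncated. -/
def annulus (n N : ℕ) : Set (EuclideanSpace ℝ (Fin n)) :=
  {y | ((N : ℝ) + 1)⁻¹ < ‖y‖ ∧ ‖y‖ < N + 1}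

theorem measurableSet_annulus (n N : ℕ) : MeasurableSet (annulus n N) :=
  (measurableSet_lt measurable_const measurable_norm).inter
    (measurableSet_lt measurable_norm measurable_const)

theorem monotone_annulus (n : ℕ) : Monotone (annulus n) := by
  intro N M h y hy
  have h' : (N : ℝ) ≤ M := Nat.cast_le.2 h
  refine ⟨lt_of_le_of_lt ?_ hy.1, hy.2.trans_le (by linarith)⟩
  exact inv_anti₀ (by positivity) (by linarith)

theorem iUnion_annulus (n : ℕ) : ⋃ N, annulus n N = {0}ᶜ := by
  ext y
  simp only [Set.mem_iUnion, Set.mem_compl_iff, Set.mem_singleton_iff]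
  constructor
  · rintro ⟨N, hN, -⟩ rfl
    rw [norm_zero] at hN
    exact absurd hN (not_lt.2 (by positivity))
  · intro hy
    have hy' : 0 < ‖y‖ := norm_pos_iff.2 hy
    obtain ⟨N, hN⟩ := exists_nat_gt (max ‖y‖ ‖y‖⁻¹)
    refine ⟨N, ?_, ?_⟩
    · have := (le_max_right ‖y‖ ‖y‖⁻¹).trans_lt hN
      exact inv_lt_of_inv_lt₀ hy' (by linarith)
    · have := (le_max_left ‖y‖ ‖y‖⁻¹).trans_lt hN
      linarith

theorem integrableOn_weight_annulus {β : ℝ} (hβ : 0 < β) (N : ℕ) :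
    IntegrableOn (weight β) (annulus n N) := by
  have hfin : volume (annulus n N) < ⊤ :=
    (measure_mono fun y (hy : y ∈ annulus n N) => mem_ball_zero_iff.2 hy.2).trans_lt
      measure_ball_lt_top
  refine Measure.integrableOn_of_bounded hfin.ne (measurable_weight β).aestronglyMeasurable
    (M := ((N : ℝ) + 1) ^ (n + β)) ?_
  filter_upwards [ae_restrict_mem (measurableSet_annulus n N)] with y hy
  have hy' : 0 < ‖y‖ := lt_trans (by positivity) hy.1
  rw [Real.norm_of_nonneg (weight_nonneg β y), weight, Real.rpow_neg hy'.le, ← Real.inv_rpow hy'.le]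
  exact Real.rpow_le_rpow (by positivity) (inv_le_of_inv_le₀ (by positivity) hy.1.le)
    (by positivity)

/-- The integral over an annulus of the symbols of the difference operators. -/
noncomputable def truncSymbol (β : ℝ) (m N : ℕ) (ξ : EuclideanSpace ℝ (Fin n)) : ℝ :=
  ∫ y in annulus n N, weight β y * diffSymbol m y ξ

theorem truncSymbol_nonneg (β : ℝ) (m N : ℕ) (ξ : EuclideanSpace ℝ (Fin n)) :
    0 ≤ truncSymbol β m N ξ :=
  integral_nonneg fun y => mul_nonneg (weight_nonneg β y) (diffSymbol_nonneg m y ξ)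

theorem truncSymbol_le (hn : 1 ≤ n) {β : ℝ} (hβ : 0 < β) {m : ℕ} (hm : β < 2 * m) (N : ℕ)
    (ξ : EuclideanSpace ℝ (Fin n)) : truncSymbol β m N ξ ≤ totalSymbol β m ξ :=
  setIntegral_le_integral (integrable_weight_mul_diffSymbol hn hβ hm ξ)
    (Eventually.of_forall fun y => mul_nonneg (weight_nonneg β y) (diffSymbol_nonneg m y ξ))

theorem tendsto_truncSymbol (hn : 1 ≤ n) {β : ℝ} (hβ : 0 < β) {m : ℕ} (hm : β < 2 * m)
    (ξ : EuclideanSpace ℝ (Fin n)) :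
    Tendsto (fun N => truncSymbol β m N ξ) atTop (𝓝 (totalSymbol β m ξ)) := by
  have : Nontrivial (EuclideanSpace ℝ (Fin n)) :=
    Module.nontrivial_of_finrank_pos (R := ℝ) (by rw [finrank_euclideanSpace_fin]; omega)
  have h := tendsto_setIntegral_of_monotone (μ := volume)
    (f := fun y => weight β y * diffSymbol m y ξ) (measurableSet_annulus n)
    (monotone_annulus n) (integrable_weight_mul_diffSymbol hn hβ hm ξ).integrableOn
  rw [iUnion_annulus, restrict_compl_singleton] at h
  exact h

theorem continuous_truncSymbol {β : ℝ} (hβ : 0 < β) (m N : ℕ) :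
    Continuous (truncSymbol β m N : EuclideanSpace ℝ (Fin n) → ℝ) := by
  refine continuous_of_dominated (F := fun ξ y => weight β y * diffSymbol m y ξ)
    (μ := volume.restrict (annulus n N)) (bound := fun y => weight β y * 4 ^ m) (fun ξ => ?_) (fun ξ => ?_)
    ((integrableOn_weight_annulus hβ N).mul_const _) ?_
  · refine ((measurable_weight β).mul ?_).aestronglyMeasurable
    exact (continuous_diffSymbol_left m ξ).measurable
  · refine Eventually.of_forall fun y => ?_
    rw [Real.norm_of_nonneg (mul_nonneg (weight_nonneg β y) (diffSymbol_nonneg m y ξ))]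
    exact mul_le_mul_of_nonneg_left (diffSymbol_le m y ξ) (weight_nonneg β y)
  · refine Eventually.of_forall fun y => continuous_const.mul ?_
    exact continuous_diffSymbol_right m y

end DifferenceSymbol

/-! ### Uniform bounds for derivatives of inverse Fourier transforms. -/

section FourierInverseBounds

variable {n : ℕ}

theorem contDiff_fourierInv {v : EuclideanSpace ℝ (Fin n) → ℂ}
    (hv : ∀ j : ℕ, Integrable fun ξ => ‖ξ‖ ^ j * ‖v ξ‖) : ContDiff ℝ ∞ (𝓕⁻ v) := by
  rw [Real.fourierInv_eq_fourier_comp_neg]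
  refine Real.contDiff_fourier (N := ⊤) fun j _ => ?_
  simpa using (hv j).comp_neg

/-- Each derivative costs a factor of at most `2π‖ξ‖` under the integral. Weighted `L^1` smallness
of the error symbol thus becomes uniform smallness of all derivatives. -/
theorem norm_iteratedFDeriv_fourierInv_le {v : EuclideanSpace ℝ (Fin n) → ℂ}
    (hv : ∀ j : ℕ, Integrable fun ξ => ‖ξ‖ ^ j * ‖v ξ‖) (hvm : AEStronglyMeasurable v) (j : ℕ)
    (x : EuclideanSpace ℝ (Fin n)) :
    ‖iteratedFDeriv ℝ j (𝓕⁻ v) x‖ ≤ (2 * Real.pi) ^ j * ∫ ξ, ‖ξ‖ ^ j * ‖v ξ‖ := by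
  have h1 : ∀ k : ℕ, Integrable fun ξ => ‖ξ‖ ^ k * ‖v (-ξ)‖ := fun k => by
    simpa using (hv k).comp_neg
  have h2 : AEStronglyMeasurable fun ξ => v (-ξ) :=
    hvm.comp_measurePreserving (Measure.measurePreserving_neg volume)
  rw [Real.fourierInv_eq_fourier_comp_neg,
    Real.iteratedFDeriv_fourier (N := ⊤) (fun k _ => h1 k) h2 (mod_cast le_top), Real.fourier_eq]
  refine (norm_integral_le_integral_norm _).trans ?_
  rw [← integral_const_mul, ← integral_neg_eq_self (fun ξ => (2 * Real.pi) ^ j * (‖ξ‖ ^ j * ‖v ξ‖))]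
  refine integral_mono_of_nonneg (Eventually.of_forall fun ξ => norm_nonneg _)
    (by simpa using (h1 j).const_mul _) (Eventually.of_forall fun ξ => ?_)
  simp only [norm_neg]
  rw [Circle.norm_smul]
  refine (VectorFourier.norm_fourierPowSMulRight_le _ _ _ _).trans ?_
  have h3 : ‖innerSL (E := EuclideanSpace ℝ (Fin n)) ℝ‖ ≤ 1 := norm_innerSL_le _
  rw [mul_assoc]
  refine mul_le_mul_of_nonneg_right (pow_le_pow_left₀ (by positivity) ?_ j) (by positivity)
  exact mul_le_of_le_one_right Real.two_pi_pos.le h3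

end FourierInverseBounds

/-! ### Centred differences: symbol, support and size. -/

section CentralDifferences

variable {n : ℕ}

/-- The centred difference of order `2 m` with step `y`. -/
noncomputable def centralDiff (m : ℕ) (ψ : EuclideanSpace ℝ (Fin n) → ℝ)
    (y x : EuclideanSpace ℝ (Fin n)) : ℝ :=
  ∑ k ∈ Finset.range (2 * m + 1), (-1) ^ (k + m) * ((2 * m).choose k : ℝ) * ψ (x + ((k : ℝ) - m) • y)

/-- With `z = exp(2πis)`, `2 - 2cos(2πs) = -z⁻¹(1 - z)²`; take the `m`-th power and expand `(1 -
z)^(2m)` by the binomial theorem. The factor `z^(-m)` centres the sum. -/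
theorem sum_choose_mul_fourierChar (m : ℕ) (s : ℝ) :
    ∑ k ∈ Finset.range (2 * m + 1), (((-1) ^ (k + m) * ((2 * m).choose k : ℝ) : ℝ) : ℂ) *
      (Real.fourierChar (((k : ℝ) - m) * s) : ℂ)
      = (((2 - 2 * Real.cos (2 * Real.pi * s)) ^ m : ℝ) : ℂ) := by
  set z : ℂ := (Real.fourierChar s : ℂ) with hz
  have hz0 : z ≠ 0 := Circle.coe_ne_zero _
  have h1 : ∀ k : ℕ, (Real.fourierChar (((k : ℝ) - m) * s) : ℂ) = z ^ k * (z⁻¹) ^ m := by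
    intro k
    rw [sub_mul, sub_eq_add_neg, AddChar.map_add_eq_mul, ← nsmul_eq_mul, ← nsmul_eq_mul,
      AddChar.map_nsmul_eq_pow, AddChar.map_neg_eq_inv, AddChar.map_nsmul_eq_pow]
    simp [hz]
  have h2 : ((2 - 2 * Real.cos (2 * Real.pi * s) : ℝ) : ℂ) = -(z⁻¹ * (1 - z) ^ 2) := by
    have h3 : z + z⁻¹ = ((2 * Real.cos (2 * Real.pi * s) : ℝ) : ℂ) := by
      rw [hz, ← Circle.coe_inv, ← AddChar.map_neg_eq_inv, Real.fourierChar_apply,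
        Real.fourierChar_apply]
      push_cast
      rw [Complex.two_cos]
      ring_nf
    rw [Complex.ofReal_sub, ← h3]
    field_simp
    push_cast
    ring
  rw [Complex.ofReal_pow, h2]
  simp_rw [h1]
  rw [neg_pow, mul_pow, ← pow_mul, sub_eq_neg_add, add_pow, Finset.mul_sum, Finset.mul_sum]
  refine Finset.sum_congr rfl fun k _ => ?_
  rw [neg_pow z]
  push_cast
  ring

theorem continuous_centralDiff (m : ℕ) {ψ : EuclideanSpace ℝ (Fin n) → ℝ} (hψ : Continuous ψ) :
    Continuous fun z : EuclideanSpace ℝ (Fin n) × EuclideanSpace ℝ (Fin n) =>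
      centralDiff m ψ z.1 z.2 := by
  unfold centralDiff
  fun_prop

theorem centralDiff_eq_fourierInv (m : ℕ) {ψ : EuclideanSpace ℝ (Fin n) → ℝ}
    {f : 𝓢(EuclideanSpace ℝ (Fin n), ℂ)} (hf : ∀ x, f x = ψ x) (y x : EuclideanSpace ℝ (Fin n)) :
    (centralDiff m ψ y x : ℂ) = 𝓕⁻ (fun ξ => (diffSymbol m y ξ : ℂ) * (𝓕 f) ξ) x := by
  have h1 : ∀ x, (ψ x : ℂ) = ∫ ξ, Real.fourierChar ⟪ξ, x⟫ • (𝓕 f) ξ := by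
    intro x
    rw [← hf, ← Real.fourierInv_eq, ← SchwartzMap.fourierInv_coe,
      FourierTransform.fourierInv_fourier_eq]
  have h2 : ∀ x : EuclideanSpace ℝ (Fin n),
      Integrable fun ξ => Real.fourierChar ⟪ξ, x⟫ • (𝓕 f) ξ := by
    intro x
    refine (𝓕 f).integrable.mono ?_ (Eventually.of_forall fun ξ => ?_)
    · refine Continuous.aestronglyMeasurable ?_
      exact (Real.continuous_fourierChar.comp (by fun_prop)).smul (𝓕 f).continuous
    · rw [Circle.norm_smul]
  rw [centralDiff, Complex.ofReal_sum, Real.fourierInv_eq]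
  simp_rw [Complex.ofReal_mul _ (ψ _), h1, ← integral_const_mul]
  rw [← integral_finsetSum _ fun k _ => (h2 _).const_mul _]
  refine integral_congr_ae (Eventually.of_forall fun ξ => ?_)
  simp only [Circle.smul_def, smul_eq_mul]
  rw [diffSymbol, ← sum_choose_mul_fourierChar, Finset.sum_mul, Finset.mul_sum]
  refine Finset.sum_congr rfl fun k _ => ?_
  rw [inner_add_right, AddChar.map_add_eq_mul, real_inner_smul_right,
    real_inner_comm ξ y]
  push_cast
  ring

theorem centralDiff_eq_zero {m : ℕ} {ψ : EuclideanSpace ℝ (Fin n) → ℝ} {R : ℝ}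
    (hψ : ∀ x, R < ‖x‖ → ψ x = 0) {y x : EuclideanSpace ℝ (Fin n)} (hx : R + m * ‖y‖ < ‖x‖) :
    centralDiff m ψ y x = 0 := by
  refine Finset.sum_eq_zero fun k hk => ?_
  rw [hψ, mul_zero]
  have hk' : (k : ℝ) ≤ 2 * m := by
    have := Finset.mem_range_succ_iff.1 hk
    exact_mod_cast this
  have h1 : ‖((k : ℝ) - m) • y‖ ≤ m * ‖y‖ := by
    rw [norm_smul]
    refine mul_le_mul_of_nonneg_right ?_ (norm_nonneg _)
    rw [Real.norm_eq_abs, abs_le]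
    constructor <;> linarith [(Nat.cast_nonneg k : (0 : ℝ) ≤ k)]
  have h2 := norm_sub_le (x + ((k : ℝ) - m) • y) (((k : ℝ) - m) • y)
  rw [add_sub_cancel_right] at h2
  linarith

/-- The vanishing of order `2m` in `y` is read off the symbol under the inverse Fourier integral,
instead of from a Taylor expansion. -/
theorem abs_centralDiff_le (m : ℕ) {ψ : EuclideanSpace ℝ (Fin n) → ℝ}
    {f : 𝓢(EuclideanSpace ℝ (Fin n), ℂ)} (hf : ∀ x, f x = ψ x) (y x : EuclideanSpace ℝ (Fin n)) :
    |centralDiff m ψ y x|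
      ≤ ((2 * Real.pi) ^ (2 * m) * ∫ ξ, ‖ξ‖ ^ (2 * m) * ‖(𝓕 f) ξ‖) * ‖y‖ ^ (2 * m) := by
  rw [← Real.norm_eq_abs, ← Complex.norm_real, centralDiff_eq_fourierInv m hf, Real.fourierInv_eq]
  refine (norm_integral_le_integral_norm _).trans ?_
  rw [mul_right_comm, ← integral_const_mul]
  refine integral_mono_of_nonneg (Eventually.of_forall fun ξ => norm_nonneg _)
    (((𝓕 f).integrable_pow_mul volume (2 * m)).const_mul _) (Eventually.of_forall fun ξ => ?_)
  simp only
  rw [Circle.norm_smul, norm_mul, Complex.norm_real, Real.norm_of_nonneg (diffSymbol_nonneg m y ξ),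
    ← mul_assoc]
  exact mul_le_mul_of_nonneg_right (diffSymbol_le_pow m y ξ) (norm_nonneg _)

theorem integral_abs_centralDiff_le (m : ℕ) {ψ : EuclideanSpace ℝ (Fin n) → ℝ}
    (hψ : Integrable ψ) (y : EuclideanSpace ℝ (Fin n)) :
    ∫ x, |centralDiff m ψ y x| ≤ 4 ^ m * ∫ x, |ψ x| := by
  have h1 : ∀ k ∈ Finset.range (2 * m + 1), Integrable fun x =>
      ((2 * m).choose k : ℝ) * |ψ (x + ((k : ℝ) - m) • y)| :=
    fun k _ => ((hψ.comp_add_right _).abs).const_mul _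
  calc ∫ x, |centralDiff m ψ y x|
      ≤ ∫ x, ∑ k ∈ Finset.range (2 * m + 1),
          ((2 * m).choose k : ℝ) * |ψ (x + ((k : ℝ) - m) • y)| := by
        refine integral_mono_of_nonneg (Eventually.of_forall fun x => abs_nonneg _)
          (integrable_finsetSum _ h1) (Eventually.of_forall fun x => ?_)
        refine (Finset.abs_sum_le_sum_abs _ _).trans (Finset.sum_le_sum fun k _ => ?_)
        rw [abs_mul, abs_mul, abs_pow, abs_neg, abs_one, one_pow, one_mul, Nat.abs_cast]
    _ = ∑ k ∈ Finset.range (2 * m + 1), ((2 * m).choose k : ℝ) * ∫ x, |ψ x| := by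
        rw [integral_finsetSum _ h1]
        refine Finset.sum_congr rfl fun k _ => ?_
        rw [integral_const_mul, integral_add_right_eq_self (fun x => |ψ x|)]
    _ = _ := by
        rw [← Finset.sum_mul, ← Nat.cast_sum, Nat.sum_range_choose, pow_mul]
        norm_num

/-- The `L^1` norms of the differences of a compactly supported function are small for small
steps. -/
theorem exists_integral_abs_centralDiff_le (m : ℕ) {ψ : EuclideanSpace ℝ (Fin n) → ℝ}
    (hψi : Integrable ψ) {R : ℝ} (hψ : ∀ x, R < ‖x‖ → ψ x = 0)
    {f : 𝓢(EuclideanSpace ℝ (Fin n), ℂ)} (hf : ∀ x, f x = ψ x) :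
    ∃ C : ℝ, ∀ y, ∫ x, |centralDiff m ψ y x| ≤ C * min 1 (‖y‖ ^ (2 * m)) := by
  set A : ℝ := (2 * Real.pi) ^ (2 * m) * ∫ ξ, ‖ξ‖ ^ (2 * m) * ‖(𝓕 f) ξ‖ with hA
  have hA0 : 0 ≤ A := mul_nonneg (by positivity) (integral_nonneg fun ξ => by positivity)
  set B : ℝ := volume.real (Metric.closedBall (0 : EuclideanSpace ℝ (Fin n)) (R + m)) with hB
  have hI0 : 0 ≤ ∫ x, |ψ x| := integral_nonneg fun x => abs_nonneg _
  refine ⟨4 ^ m * (∫ x, |ψ x|) + A * B, fun y => ?_⟩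
  -- Large steps use translation invariance of the `L^1` norm. For small steps the difference lives
  -- in the ball of radius `R + m`, where the uniform bound is integrated.
  rcases le_total 1 ‖y‖ with hy | hy
  · rw [min_eq_left (one_le_pow₀ hy), mul_one]
    exact (integral_abs_centralDiff_le m hψi y).trans (le_add_of_nonneg_right
      (mul_nonneg hA0 measureReal_nonneg))
  · rw [min_eq_right (pow_le_one₀ (norm_nonneg _) hy)]
    have h1 : ∫ x, |centralDiff m ψ y x|
        = ∫ x in Metric.closedBall 0 (R + m), |centralDiff m ψ y x| := by
      refine (setIntegral_eq_integral_of_forall_compl_eq_zero fun x hx => ?_).symm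
      rw [mem_closedBall_zero_iff, not_le] at hx
      rw [centralDiff_eq_zero hψ, abs_zero]
      have := mul_le_of_le_one_right (Nat.cast_nonneg m : (0 : ℝ) ≤ m) hy
      linarith
    have h2 : ∫ x in Metric.closedBall 0 (R + m), |centralDiff m ψ y x|
        ≤ A * ‖y‖ ^ (2 * m) * B := by
      refine (Real.le_norm_self _).trans (norm_setIntegral_le_of_norm_le_const
        measure_closedBall_lt_top fun x _ => ?_)
      rw [Real.norm_eq_abs, abs_abs]
      exact abs_centralDiff_le m hf y x
    rw [h1]
    refine h2.trans ?_
    have : 0 ≤ 4 ^ m * (∫ x, |ψ x|) * ‖y‖ ^ (2 * m) := by positivity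
    nlinarith

end CentralDifferences

/-! ### Truncated hypersingular integrals: Fourier transform and uniform `L^1` bound. -/

section TruncatedDifferences

variable {n : ℕ}

/-- The truncated integral of centred differences against the homogeneous weight, approximating a
multiple of a fractional power of the Laplacian. -/
noncomputable def truncDiff (β : ℝ) (m N : ℕ) (ψ : EuclideanSpace ℝ (Fin n) → ℝ)
    (x : EuclideanSpace ℝ (Fin n)) : ℝ :=
  ∫ y in annulus n N, weight β y * centralDiff m ψ y x

theorem truncDiff_eq_fourierInv {β : ℝ} (hβ : 0 < β) (m N : ℕ)
    {ψ : EuclideanSpace ℝ (Fin n) → ℝ} {f : 𝓢(EuclideanSpace ℝ (Fin n), ℂ)}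
    (hf : ∀ x, f x = ψ x) (x : EuclideanSpace ℝ (Fin n)) :
    (truncDiff β m N ψ x : ℂ) = 𝓕⁻ (fun ξ => (truncSymbol β m N ξ : ℂ) * (𝓕 f) ξ) x := by
  have hchar : Continuous fun ξ => Real.fourierChar ⟪ξ, x⟫ • (𝓕 f) ξ :=
    (Real.continuous_fourierChar.comp (by fun_prop)).smul (𝓕 f).continuous
  have hint : ∀ ξ : EuclideanSpace ℝ (Fin n),
      IntegrableOn (fun y => weight β y * diffSymbol m y ξ) (annulus n N) := by
    intro ξ
    refine ((integrableOn_weight_annulus hβ N).mul_const (4 ^ m)).mono' ?_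
      (Eventually.of_forall fun y => ?_)
    · exact ((measurable_weight β).mul
        (continuous_diffSymbol_left m ξ).measurable).aestronglyMeasurable
    · rw [Real.norm_of_nonneg (mul_nonneg (weight_nonneg β y) (diffSymbol_nonneg m y ξ))]
      exact mul_le_mul_of_nonneg_left (diffSymbol_le m y ξ) (weight_nonneg β y)
  have h1 := integral_integral_mul_swap (μ := volume) (ν := volume.restrict (annulus n N))
    (p := fun ξ y => weight β y * diffSymbol m y ξ)
    (h := fun ξ => Real.fourierChar ⟪ξ, x⟫ • (𝓕 f) ξ) ?_ ?_ (Eventually.of_forall hint)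
    hchar.aestronglyMeasurable ?_
  · rw [truncDiff, ← integral_complex_ofReal, Real.fourierInv_eq]
    refine Eq.trans ?_ (h1.symm.trans ?_)
    rotate_left
    · refine integral_congr_ae (Eventually.of_forall fun ξ => ?_)
      simp only [Circle.smul_def, smul_eq_mul, truncSymbol]
      ring
    refine integral_congr_ae (Eventually.of_forall fun y => ?_)
    simp only
    rw [Complex.ofReal_mul, centralDiff_eq_fourierInv m hf, Real.fourierInv_eq,
      ← integral_const_mul]
    refine integral_congr_ae (Eventually.of_forall fun ξ => ?_)
    simp only [Circle.smul_def, smul_eq_mul]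
    push_cast
    ring
  · refine Measurable.aestronglyMeasurable ?_
    exact ((measurable_weight β).comp measurable_snd).mul
      ((continuous_diffSymbol m).comp continuous_swap).measurable
  · exact fun ξ => Eventually.of_forall fun y =>
      mul_nonneg (weight_nonneg β y) (diffSymbol_nonneg m y ξ)
  · refine ((𝓕 f).integrable.norm.const_mul (∫ y in annulus n N, weight β y * 4 ^ m)).mono' ?_
      (Eventually.of_forall fun ξ => ?_)
    · exact ((Complex.continuous_ofReal.comp
        (continuous_truncSymbol hβ m N)).mul hchar).aestronglyMeasurable
    · rw [norm_mul, Circle.norm_smul, Complex.norm_real]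
      refine mul_le_mul_of_nonneg_right ?_ (norm_nonneg _)
      rw [Real.norm_of_nonneg (integral_nonneg fun y =>
        mul_nonneg (weight_nonneg β y) (diffSymbol_nonneg m y ξ))]
      refine setIntegral_mono (hint ξ) ((integrableOn_weight_annulus hβ N).mul_const (4 ^ m))
        fun y => ?_
      exact mul_le_mul_of_nonneg_left (diffSymbol_le m y ξ) (weight_nonneg β y)

theorem integrable_pow_mul_truncSymbol_mul {β : ℝ} (hβ : 0 < β) (m N : ℕ)
    (f : 𝓢(EuclideanSpace ℝ (Fin n), ℂ)) (j : ℕ) :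
    Integrable fun ξ => ‖ξ‖ ^ j * ‖(truncSymbol β m N ξ : ℂ) * (𝓕 f) ξ‖ := by
  refine (((𝓕 f).integrable_pow_mul volume j).const_mul
    (∫ y in annulus n N, weight β y * 4 ^ m)).mono' ?_ (Eventually.of_forall fun ξ => ?_)
  · refine Continuous.aestronglyMeasurable ?_
    have h1 := continuous_truncSymbol (n := n) hβ m N
    have h2 := (𝓕 f).continuous
    fun_prop
  · rw [norm_mul, norm_norm, norm_mul, Complex.norm_real, norm_pow, norm_norm, mul_left_comm]
    refine mul_le_mul_of_nonneg_right ?_ (by positivity)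
    refine norm_integral_le_of_norm_le ((integrableOn_weight_annulus hβ N).mul_const (4 ^ m))
      (Eventually.of_forall fun y => ?_)
    rw [Real.norm_of_nonneg (mul_nonneg (weight_nonneg β y) (diffSymbol_nonneg m y ξ))]
    exact mul_le_mul_of_nonneg_left (diffSymbol_le m y ξ) (weight_nonneg β y)

theorem contDiff_truncDiff {β : ℝ} (hβ : 0 < β) (m N : ℕ)
    {ψ : EuclideanSpace ℝ (Fin n) → ℝ} {f : 𝓢(EuclideanSpace ℝ (Fin n), ℂ)}
    (hf : ∀ x, f x = ψ x) : ContDiff ℝ ∞ (truncDiff β m N ψ) := by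
  have h1 := contDiff_fourierInv (integrable_pow_mul_truncSymbol_mul hβ m N f)
  have h2 : truncDiff β m N ψ
      = fun x => Complex.reCLM (𝓕⁻ (fun ξ => (truncSymbol β m N ξ : ℂ) * (𝓕 f) ξ) x) := by
    funext x
    rw [← truncDiff_eq_fourierInv hβ m N hf]
    rfl
  rw [h2]
  exact Complex.reCLM.contDiff.comp h1

theorem hasCompactSupport_truncDiff (β : ℝ) (m N : ℕ) {ψ : EuclideanSpace ℝ (Fin n) → ℝ} {R : ℝ}
    (hψ : ∀ x, R < ‖x‖ → ψ x = 0) : HasCompactSupport (truncDiff β m N ψ) := by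
  refine HasCompactSupport.intro (isCompact_closedBall 0 (R + m * (N + 1))) fun x hx => ?_
  rw [mem_closedBall_zero_iff, not_le] at hx
  refine setIntegral_eq_zero_of_forall_eq_zero fun y hy => ?_
  rw [centralDiff_eq_zero hψ, mul_zero]
  have := mul_le_mul_of_nonneg_left hy.2.le (Nat.cast_nonneg m : (0 : ℝ) ≤ m)
  linarith

/-- The Fourier transform of the truncated integral of differences. -/
theorem fourier_truncDiff {β : ℝ} (hβ : 0 < β) (m N : ℕ)
    {ψ : EuclideanSpace ℝ (Fin n) → ℝ} {R : ℝ} (hψ : ∀ x, R < ‖x‖ → ψ x = 0)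
    {f : 𝓢(EuclideanSpace ℝ (Fin n), ℂ)} (hf : ∀ x, f x = ψ x) :
    𝓕 (fun x => (truncDiff β m N ψ x : ℂ)) = fun ξ => (truncSymbol β m N ξ : ℂ) * (𝓕 f) ξ := by
  have h1 : (fun x => (truncDiff β m N ψ x : ℂ))
      = 𝓕⁻ (fun ξ => (truncSymbol β m N ξ : ℂ) * (𝓕 f) ξ) :=
    funext fun x => truncDiff_eq_fourierInv hβ m N hf x
  have hc : Continuous fun ξ => (truncSymbol β m N ξ : ℂ) * (𝓕 f) ξ :=
    (Complex.continuous_ofReal.comp (continuous_truncSymbol hβ m N)).mul (𝓕 f).continuous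
  have hi : Integrable fun ξ => (truncSymbol β m N ξ : ℂ) * (𝓕 f) ξ := by
    rw [← integrable_norm_iff hc.aestronglyMeasurable]
    simpa using integrable_pow_mul_truncSymbol_mul hβ m N f 0
  rw [h1]
  -- Inversion needs the transform of the symbol side to be integrable; up to reflection it is the
  -- truncated integral itself, which is continuous with compact support.
  refine Continuous.fourier_fourierInv_eq hc hi ?_
  have h2 : Integrable fun x => (truncDiff β m N ψ x : ℂ) :=
    ((contDiff_truncDiff hβ m N hf).continuous.integrable_of_hasCompactSupport
      (hasCompactSupport_truncDiff β m N hψ)).ofReal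
  rw [h1] at h2
  simpa [Real.fourierInv_eq_fourier_neg] using h2.comp_neg

/-- The truncated integrals of differences are bounded in `L^1`. -/
theorem exists_integral_norm_truncDiff_le (hn : 1 ≤ n) {β : ℝ} (hβ : 0 < β) {m : ℕ}
    (hm : β < 2 * m) {ψ : EuclideanSpace ℝ (Fin n) → ℝ} (hψc : Continuous ψ)
    {R : ℝ} (hψ : ∀ x, R < ‖x‖ → ψ x = 0)
    {f : 𝓢(EuclideanSpace ℝ (Fin n), ℂ)} (hf : ∀ x, f x = ψ x) :
    ∃ B : ℝ, ∀ N, ∫ x, ‖truncDiff β m N ψ x‖ ≤ B := by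
  have hψs : HasCompactSupport ψ :=
    HasCompactSupport.intro (isCompact_closedBall 0 R) fun x hx => hψ x (by simpa using hx)
  have hψi := hψc.integrable_of_hasCompactSupport (μ := volume) hψs
  obtain ⟨C, hC⟩ := exists_integral_abs_centralDiff_le m hψi hψ hf
  have hmin := (integrable_weight_mul_min hn hβ hm).const_mul C
  have hsec : ∀ y, Integrable fun x => centralDiff m ψ y x := by
    intro y
    unfold centralDiff
    exact integrable_finsetSum _ fun k _ => (hψi.comp_add_right _).const_mul _
  -- Integrating the majorant over the whole space removes the dependence on the annulus.
  refine ⟨∫ y : EuclideanSpace ℝ (Fin n), C * (weight β y * min 1 (‖y‖ ^ (2 * m))), fun N => ?_⟩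
  have hmeas : AEStronglyMeasurable (fun z : EuclideanSpace ℝ (Fin n) × EuclideanSpace ℝ (Fin n) =>
      weight β z.2 * centralDiff m ψ z.2 z.1) (volume.prod (volume.restrict (annulus n N))) := by
    refine Measurable.aestronglyMeasurable ?_
    exact ((measurable_weight β).comp measurable_snd).mul
      ((continuous_centralDiff m hψc).comp continuous_swap).measurable
  have hnorm : ∀ y, ∫ x, ‖weight β y * centralDiff m ψ y x‖
      = weight β y * ∫ x, |centralDiff m ψ y x| := by
    intro y
    simp_rw [norm_mul, Real.norm_of_nonneg (weight_nonneg β y), Real.norm_eq_abs]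
    rw [integral_const_mul]
  have hle : ∀ y, weight β y * ∫ x, |centralDiff m ψ y x|
      ≤ C * (weight β y * min 1 (‖y‖ ^ (2 * m))) := by
    intro y
    rw [mul_left_comm]
    exact mul_le_mul_of_nonneg_left (hC y) (weight_nonneg β y)
  have hnn : ∀ y, 0 ≤ weight β y * ∫ x, |centralDiff m ψ y x| := fun y =>
    mul_nonneg (weight_nonneg β y) (integral_nonneg fun x => abs_nonneg _)
  have hprod : Integrable (fun z : EuclideanSpace ℝ (Fin n) × EuclideanSpace ℝ (Fin n) =>
      weight β z.2 * centralDiff m ψ z.2 z.1) (volume.prod (volume.restrict (annulus n N))) := by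
    refine (integrable_prod_iff' hmeas).2 ⟨Eventually.of_forall fun y => (hsec y).const_mul (weight β y), ?_⟩
    refine hmin.integrableOn.mono' hmeas.norm.prod_swap.integral_prod_right' ?_
    refine Eventually.of_forall fun y => ?_
    simp only
    rw [hnorm, Real.norm_of_nonneg (hnn y)]
    exact hle y
  calc ∫ x, ‖truncDiff β m N ψ x‖
      ≤ ∫ x, ∫ y in annulus n N, ‖weight β y * centralDiff m ψ y x‖ := by
        refine integral_mono_of_nonneg (Eventually.of_forall fun x => norm_nonneg _)
          hprod.norm.integral_prod_left (Eventually.of_forall fun x => ?_)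
        exact norm_integral_le_integral_norm _
    _ = ∫ y in annulus n N, ∫ x, ‖weight β y * centralDiff m ψ y x‖ :=
        integral_integral_swap hprod.norm
    _ ≤ ∫ y in annulus n N, C * (weight β y * min 1 (‖y‖ ^ (2 * m))) := by
        simp_rw [hnorm]
        exact integral_mono_of_nonneg (Eventually.of_forall hnn) hmin.integrableOn
          (Eventually.of_forall hle)
    _ ≤ _ := setIntegral_le_integral hmin (Eventually.of_forall fun y => (hnn y).trans (hle y))

end TruncatedDifferences

/-! ### Test functions whose potentials approximate a function equal to one on the unit ball. -/

section ApproximatePreimage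

variable {n : ℕ}

/-- The relative error of the truncated symbol, times the `i`-th coordinate. -/
noncomputable def symbolError (β : ℝ) (m : ℕ) (i : Fin n) (N : ℕ)
    (ξ : EuclideanSpace ℝ (Fin n)) : ℝ :=
  ξ i * (‖ξ‖ ^ (-β) * truncSymbol β m N ξ / totalSymbol β m (EuclideanSpace.single i (1 : ℝ)) - 1)

theorem measurable_symbolError {β : ℝ} (hβ : 0 < β) (m : ℕ) (i : Fin n) (N : ℕ) :
    Measurable (symbolError β m i N) := by
  have h1 := (continuous_truncSymbol (n := n) hβ m N).measurable
  have h2 : Measurable fun ξ : EuclideanSpace ℝ (Fin n) => ‖ξ‖ ^ (-β) :=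
    measurable_norm.pow_const _
  unfold symbolError
  fun_prop

/-- The truncated symbol lies between zero and the full one, a multiple of `|ξ|^β`; so for `ξ ≠ 0`
the relative error lies in `[-1, 0]`. -/
theorem abs_symbolError_le {β : ℝ} (hβ : 0 < β) {m : ℕ} (hm : β < 2 * m) (i : Fin n) (N : ℕ)
    (ξ : EuclideanSpace ℝ (Fin n)) : |symbolError β m i N ξ| ≤ ‖ξ‖ := by
  have hn : 1 ≤ n := by have := i.2; omega
  have hm0 : m ≠ 0 := by rintro rfl; norm_num at hm; linarith
  have he : ‖EuclideanSpace.single i (1 : ℝ)‖ = 1 := by simp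
  rcases eq_or_ne ξ 0 with rfl | hξ
  · simp [symbolError]
  have hξ' : 0 < ‖ξ‖ := norm_pos_iff.2 hξ
  have hC := totalSymbol_pos hn hβ hm he
  rw [symbolError, abs_mul]
  refine (mul_le_mul (PiLp.norm_apply_le ξ i) ?_ (abs_nonneg _) hξ'.le).trans_eq (mul_one _)
  have h1 : 0 ≤ ‖ξ‖ ^ (-β) * truncSymbol β m N ξ
      / totalSymbol β m (EuclideanSpace.single i (1 : ℝ)) :=
    div_nonneg (mul_nonneg (Real.rpow_nonneg hξ'.le _) (truncSymbol_nonneg β m N ξ)) hC.le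
  have h2 : ‖ξ‖ ^ (-β) * truncSymbol β m N ξ
      / totalSymbol β m (EuclideanSpace.single i (1 : ℝ)) ≤ 1 := by
    rw [div_le_one hC, Real.rpow_neg hξ'.le, inv_mul_le_iff₀ (by positivity), mul_comm,
      ← totalSymbol_eq hβ hm0 he]
    exact truncSymbol_le hn hβ hm N ξ
  rw [abs_le]
  constructor <;> linarith

theorem tendsto_symbolError {β : ℝ} (hβ : 0 < β) {m : ℕ} (hm : β < 2 * m) (i : Fin n)
    (ξ : EuclideanSpace ℝ (Fin n)) :
    Tendsto (fun N => symbolError β m i N ξ) atTop (𝓝 0) := by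
  have hn : 1 ≤ n := by have := i.2; omega
  have hm0 : m ≠ 0 := by rintro rfl; norm_num at hm; linarith
  have he : ‖EuclideanSpace.single i (1 : ℝ)‖ = 1 := by simp
  rcases eq_or_ne ξ 0 with rfl | hξ
  · simp [symbolError]
  have hξ' : 0 < ‖ξ‖ := norm_pos_iff.2 hξ
  have hC := totalSymbol_pos hn hβ hm he
  have h1 := ((((tendsto_truncSymbol hn hβ hm ξ).const_mul (‖ξ‖ ^ (-β))).div_const
    (totalSymbol β m (EuclideanSpace.single i (1 : ℝ)))).sub_const 1).const_mul (ξ i)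
  have h2 : ‖ξ‖ ^ (-β) * totalSymbol β m ξ
      / totalSymbol β m (EuclideanSpace.single i (1 : ℝ)) = 1 := by
    rw [totalSymbol_eq hβ hm0 he ξ, Real.rpow_neg hξ'.le]
    have := Real.rpow_pos_of_pos hξ' β
    field_simp
  rw [h2, sub_self, mul_zero] at h1
  exact h1

theorem integrable_pow_mul_symbolError_mul {β : ℝ} (hβ : 0 < β) {m : ℕ} (hm : β < 2 * m)
    (i : Fin n) (N : ℕ) (f : 𝓢(EuclideanSpace ℝ (Fin n), ℂ)) (j : ℕ) :
    Integrable fun ξ => ‖ξ‖ ^ j * ‖(symbolError β m i N ξ : ℂ) * f ξ‖ := by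
  refine (f.integrable_pow_mul volume (j + 1)).mono' ?_ (Eventually.of_forall fun ξ => ?_)
  · have h1 := measurable_symbolError hβ m i N
    have h2 := f.continuous.measurable
    exact Measurable.aestronglyMeasurable (by fun_prop)
  · rw [norm_mul, norm_norm, norm_mul, Complex.norm_real, norm_pow, norm_norm, pow_succ, mul_assoc]
    gcongr
    exact abs_symbolError_le hβ hm i N ξ

/-- Dominated convergence, with the Schwartz decay of `f` absorbing the factor `‖ξ‖^(j+1)`. -/
theorem tendsto_integral_symbolError {β : ℝ} (hβ : 0 < β) {m : ℕ} (hm : β < 2 * m)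
    (i : Fin n) (f : 𝓢(EuclideanSpace ℝ (Fin n), ℂ)) (j : ℕ) :
    Tendsto (fun N => ∫ ξ, ‖ξ‖ ^ j * ‖(symbolError β m i N ξ : ℂ) * f ξ‖) atTop (𝓝 0) := by
  rw [← integral_zero (EuclideanSpace ℝ (Fin n)) ℝ]
  refine tendsto_integral_of_dominated_convergence (fun ξ => ‖ξ‖ ^ (j + 1) * ‖f ξ‖)
    (fun N => (integrable_pow_mul_symbolError_mul hβ hm i N f j).aestronglyMeasurable)
    (f.integrable_pow_mul volume (j + 1)) (fun N => Eventually.of_forall fun ξ => ?_)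
    (Eventually.of_forall fun ξ => ?_)
  · rw [norm_mul, norm_norm, norm_mul, Complex.norm_real, norm_pow, norm_norm, pow_succ, mul_assoc]
    gcongr
    exact abs_symbolError_le hβ hm i N ξ
  · simp_rw [norm_mul, Complex.norm_real]
    simpa using ((tendsto_symbolError hβ hm i ξ).norm.mul_const ‖f ξ‖).const_mul (‖ξ‖ ^ j)

/-- Partial derivatives as Fourier multipliers. -/
theorem fderiv_eq_fourierInv (f : 𝓢(EuclideanSpace ℝ (Fin n), ℂ)) (i : Fin n)
    (x : EuclideanSpace ℝ (Fin n)) :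
    fderiv ℝ f x (EuclideanSpace.single i 1)
      = 2 * Real.pi * Complex.I * 𝓕⁻ (fun ξ : EuclideanSpace ℝ (Fin n) => (ξ i : ℂ) * (𝓕 f) ξ) x := by
  have hg : (fun ξ : EuclideanSpace ℝ (Fin n) =>
      ⟪ξ, EuclideanSpace.single i (1 : ℝ)⟫).HasTemperateGrowth :=
    ((innerSL ℝ).flip (EuclideanSpace.single i (1 : ℝ))).hasTemperateGrowth
  rw [← SchwartzMap.lineDerivOp_apply_eq_fderiv,
    ← FourierTransform.fourierInv_fourier_eq (F := 𝓢(EuclideanSpace ℝ (Fin n), ℂ))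
      (∂_{EuclideanSpace.single i (1 : ℝ)} f),
    SchwartzMap.fourier_lineDerivOp_eq, SchwartzMap.fourierInv_coe, ← fourierInv_const_mul]
  refine congrArg (fun a : EuclideanSpace ℝ (Fin n) → ℂ => 𝓕⁻ a x) (funext fun ξ => ?_)
  rw [smul_apply, SchwartzMap.smulLeftCLM_apply_apply hg]
  simp [EuclideanSpace.inner_single_right]

theorem fourierInv_add {a b : EuclideanSpace ℝ (Fin n) → ℂ} (ha : Integrable a)
    (hb : Integrable b) (x : EuclideanSpace ℝ (Fin n)) :
    𝓕⁻ (fun ξ => a ξ + b ξ) x = 𝓕⁻ a x + 𝓕⁻ b x := by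
  have h : ∀ {c : EuclideanSpace ℝ (Fin n) → ℂ}, Integrable c →
      Integrable fun ξ => Real.fourierChar ⟪ξ, x⟫ • c ξ := by
    intro c hc
    refine hc.mono ?_ (Eventually.of_forall fun ξ => (Circle.norm_smul _ _).le)
    have h1 : Continuous fun ξ => Real.fourierChar ⟪ξ, x⟫ :=
      Real.continuous_fourierChar.comp (by fun_prop)
    exact h1.aestronglyMeasurable.smul hc.aestronglyMeasurable
  simp_rw [Real.fourierInv_eq, smul_add]
  exact integral_add (h ha) (h hb)

theorem ofReal_kernelConv (α : ℝ) (i : Fin n) (g : EuclideanSpace ℝ (Fin n) → ℝ)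
    (x : EuclideanSpace ℝ (Fin n)) :
    (kernelConv α i g x : ℂ) = ∫ z, (kernel α i z : ℂ) * (g (x - z) : ℂ) := by
  rw [kernelConv, convolution_def, ← integral_complex_ofReal]
  simp

/-- The potential of the truncated integral of differences, up to a constant, is a partial
derivative plus an error term. -/
theorem exists_kernelConv_truncDiff {α : ℝ} (hα0 : 0 < α) (hαn : α < n) (i : Fin n) :
    ∃ A : ℝ, ∀ (N : ℕ) {ψ : EuclideanSpace ℝ (Fin n) → ℝ} {R : ℝ}
      (_ : ∀ x, R < ‖x‖ → ψ x = 0) {f : 𝓢(EuclideanSpace ℝ (Fin n), ℂ)}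
      (_ : ∀ x, f x = ψ x) (x : EuclideanSpace ℝ (Fin n)),
      ((A * kernelConv α i (truncDiff (n + 1 - α) n N ψ) x : ℝ) : ℂ)
        - fderiv ℝ f x (EuclideanSpace.single i 1)
        = 2 * Real.pi * Complex.I *
          𝓕⁻ (fun ξ => (symbolError (n + 1 - α) n i N ξ : ℂ) * (𝓕 f) ξ) x := by
  have hn : 1 ≤ n := by have := i.2; omega
  have hn' : (1 : ℝ) ≤ n := by exact_mod_cast hn
  have hβ : 0 < (n : ℝ) + 1 - α := by linarith
  -- Differences of order `2n` suffice, because `n ≥ 1` and `α > 0`.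
  have hm : (n : ℝ) + 1 - α < 2 * n := by linarith
  have he : ‖EuclideanSpace.single i (1 : ℝ)‖ = 1 := by simp
  have hC := totalSymbol_pos hn hβ hm he
  set β : ℝ := n + 1 - α with hβdef
  set C := totalSymbol β n (EuclideanSpace.single i (1 : ℝ)) with hCdef
  set K₀ : ℝ := (1 / Real.pi) ^ ((1 + α) / 2) * Real.Gamma ((1 + α) / 2) with hK₀
  set K₁ : ℝ := (1 / Real.pi) ^ (β / 2) * Real.Gamma (β / 2) with hK₁
  have hK₀' : 0 < K₀ :=
    mul_pos (Real.rpow_pos_of_pos (by positivity) _) (Real.Gamma_pos_of_pos (by positivity))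
  have hK₁' : 0 < K₁ :=
    mul_pos (Real.rpow_pos_of_pos (by positivity) _) (Real.Gamma_pos_of_pos (by positivity))
  -- The kernel has symbol `-i (K₁/K₀) ξᵢ‖ξ‖^(-β)` and the full difference integral has symbol
  -- `C‖ξ‖^β`; this constant makes their product `2πi ξᵢ`, the symbol of the partial derivative.
  refine ⟨-(2 * Real.pi * K₀) / (K₁ * C), fun N ψ R hψ f hf x => ?_⟩
  have hs := contDiff_truncDiff hβ n N hf
  have hc := hasCompactSupport_truncDiff β n N hψ
  have hs' : ContDiff ℝ ∞ fun x => (truncDiff β n N ψ x : ℂ) :=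
    Complex.ofRealCLM.contDiff.comp hs
  have hc' : HasCompactSupport fun x => (truncDiff β n N ψ x : ℂ) :=
    hc.comp_left (g := Complex.ofReal) Complex.ofReal_zero
  have h1 := integral_kernel_mul_eq_fourierInv hα0 hαn i (hc'.toSchwartzMap hs') x
  rw [SchwartzMap.fourier_coe] at h1
  have h2 : ⇑(hc'.toSchwartzMap hs') = fun x => (truncDiff β n N ψ x : ℂ) := rfl
  rw [h2, fourier_truncDiff hβ n N hψ hf] at h1
  simp only at h1
  rw [← ofReal_kernelConv, ← hβdef, ← hK₀, ← hK₁] at h1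
  have hi1 : Integrable fun ξ => (symbolError β n i N ξ : ℂ) * (𝓕 f) ξ := by
    have hmeas : Measurable fun ξ => (symbolError β n i N ξ : ℂ) * (𝓕 f) ξ := by
      have h3 := measurable_symbolError hβ n i N
      have h4 := (𝓕 f).continuous.measurable
      fun_prop
    rw [← integrable_norm_iff hmeas.aestronglyMeasurable]
    simpa using integrable_pow_mul_symbolError_mul hβ hm i N (𝓕 f) 0
  have hi2 : Integrable fun ξ : EuclideanSpace ℝ (Fin n) => (ξ i : ℂ) * (𝓕 f) ξ := by
    have hcont : Continuous fun ξ : EuclideanSpace ℝ (Fin n) => (ξ i : ℂ) * (𝓕 f) ξ := by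
      have h4 := (𝓕 f).continuous
      fun_prop
    refine ((𝓕 f).integrable_pow_mul volume 1).mono' hcont.aestronglyMeasurable
      (Eventually.of_forall fun ξ => ?_)
    rw [norm_mul, Complex.norm_real, pow_one]
    exact mul_le_mul_of_nonneg_right (PiLp.norm_apply_le ξ i) (norm_nonneg _)
  have h5 : (fun ξ => ((ξ i * ‖ξ‖ ^ (-β) : ℝ) : ℂ) * ((truncSymbol β n N ξ : ℂ) * (𝓕 f) ξ))
      = fun ξ => (C : ℂ) * ((symbolError β n i N ξ : ℂ) * (𝓕 f) ξ + (ξ i : ℂ) * (𝓕 f) ξ) := by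
    funext ξ
    have hC' : (C : ℂ) ≠ 0 := by exact_mod_cast hC.ne'
    rw [symbolError, ← hCdef]
    push_cast
    field_simp
    ring
  rw [h5, fourierInv_const_mul, fourierInv_add hi1 hi2] at h1
  rw [fderiv_eq_fourierInv, sub_eq_iff_eq_add, ← mul_add]
  have hC' : (C : ℂ) ≠ 0 := by exact_mod_cast hC.ne'
  have hK₀'' : (K₀ : ℂ) ≠ 0 := by exact_mod_cast hK₀'.ne'
  have hK₁'' : (K₁ : ℂ) ≠ 0 := by exact_mod_cast hK₁'.ne'
  push_cast
  rw [div_mul_eq_mul_div, div_eq_iff (mul_ne_zero hK₁'' hC')]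
  linear_combination (-(2 * Real.pi : ℂ)) * h1

/-- A smooth function, equal to one on the unit ball, is the limit, with all derivatives and
uniformly on the whole space, of potentials of test functions that are bounded in `L^1`. -/
theorem exists_approximate_preimage {α : ℝ} (hα0 : 0 < α) (hαn : α < n) (i : Fin n) :
    ∃ (B : ℝ) (φ : EuclideanSpace ℝ (Fin n) → ℝ)
      (g : ℕ → 𝓓((⊤ : Opens (EuclideanSpace ℝ (Fin n))), ℝ)) (δ : ℕ → ℕ → ℝ),
      ContDiff ℝ ∞ φ ∧ (∀ x ∈ Metric.ball 0 1, φ x = 1) ∧ (∀ N, ∫ x, ‖g N x‖ ≤ B) ∧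
      (∀ j, Tendsto (δ j) atTop (𝓝 0)) ∧
      ∀ j N x, ‖iteratedFDeriv ℝ j (fun x => kernelConv α i (g N) x - φ x) x‖ ≤ δ j N := by
  have hn : 1 ≤ n := by have := i.2; omega
  have hn' : (1 : ℝ) ≤ n := by exact_mod_cast hn
  have hβ : 0 < (n : ℝ) + 1 - α := by linarith
  have hm : (n : ℝ) + 1 - α < 2 * n := by linarith
  obtain ⟨χ, hχ⟩ := exists_cutoff (isCompact_closedBall (0 : EuclideanSpace ℝ (Fin n)) 1)
  -- The cutoff is one near the closed unit ball, so there `∂ᵢψ = ∂ᵢxᵢ = 1`.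
  set ψ : EuclideanSpace ℝ (Fin n) → ℝ := fun x => x i * χ x with hψdef
  have hcoord : ContDiff ℝ ∞ fun x : EuclideanSpace ℝ (Fin n) => x i := by fun_prop
  have hψs : ContDiff ℝ ∞ ψ := hcoord.mul χ.contDiff
  have hψc : HasCompactSupport ψ := χ.hasCompactSupport.mul_left
  obtain ⟨R, hR⟩ := hψc.isBounded.subset_closedBall 0
  have hψ : ∀ x, R < ‖x‖ → ψ x = 0 := fun x hx =>
    image_eq_zero_of_notMem_tsupport fun h => by
      have := mem_closedBall_zero_iff.1 (hR h)
      linarith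
  have hs' : ContDiff ℝ ∞ fun x => (ψ x : ℂ) := Complex.ofRealCLM.contDiff.comp hψs
  have hc' : HasCompactSupport fun x => (ψ x : ℂ) :=
    hψc.comp_left (g := Complex.ofReal) Complex.ofReal_zero
  set f := hc'.toSchwartzMap hs' with hfdef
  have hf : ∀ x, f x = ψ x := fun x => rfl
  obtain ⟨A, hA⟩ := exists_kernelConv_truncDiff hα0 hαn i
  obtain ⟨B, hB⟩ := exists_integral_norm_truncDiff_le hn hβ hm hψs.continuous hψ hf
  set φ : EuclideanSpace ℝ (Fin n) → ℝ :=
    fun x => fderiv ℝ ψ x (EuclideanSpace.single i 1) with hφdef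
  have hφs : ContDiff ℝ ∞ φ := (hψs.fderiv_right (m := ∞) le_rfl).clm_apply contDiff_const
  have hφf : ∀ x, (φ x : ℂ) = fderiv ℝ f x (EuclideanSpace.single i 1) := by
    intro x
    have h1 : HasFDerivAt (fun x => (ψ x : ℂ)) (Complex.ofRealCLM.comp (fderiv ℝ ψ x)) x :=
      Complex.ofRealCLM.hasFDerivAt.comp x
        ((hψs.differentiable (by simp)).differentiableAt.hasFDerivAt)
    have h2 : fderiv ℝ f x = Complex.ofRealCLM.comp (fderiv ℝ ψ x) := h1.fderiv
    rw [h2]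
    rfl
  let g : ℕ → 𝓓((⊤ : Opens (EuclideanSpace ℝ (Fin n))), ℝ) := fun N =>
    { toFun := fun x => A * truncDiff (n + 1 - α) n N ψ x
      contDiff' := contDiff_const.mul (contDiff_truncDiff hβ n N hf)
      hasCompactSupport' := (hasCompactSupport_truncDiff _ n N hψ).mul_left
      tsupport_subset' := by simp }
  have hg : ∀ N x, g N x = A * truncDiff (n + 1 - α) n N ψ x := fun N x => rfl
  have hgc : ∀ N x, kernelConv α i (g N) x
      = A * kernelConv α i (truncDiff (n + 1 - α) n N ψ) x := by
    intro N x
    rw [kernelConv, kernelConv, convolution_def, convolution_def, ← integral_const_mul]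
    refine integral_congr_ae (Eventually.of_forall fun z => ?_)
    simp only [hg, ContinuousLinearMap.mul_apply']
    ring
  refine ⟨|A| * B, φ, g, fun j N => 2 * Real.pi * ((2 * Real.pi) ^ j *
    ∫ ξ, ‖ξ‖ ^ j * ‖(symbolError (n + 1 - α) n i N ξ : ℂ) * (𝓕 f) ξ‖), hφs, ?_, ?_, ?_, ?_⟩
  · intro x hx
    have h1 : ψ =ᶠ[𝓝 x] fun y => (EuclideanSpace.proj i : EuclideanSpace ℝ (Fin n) →L[ℝ] ℝ) y := by
      filter_upwards [eventually_nhdsSet_iff_forall.1 hχ x (Metric.ball_subset_closedBall hx)]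
        with y hy
      simp [hψdef, hy]
    simp only [hφdef]
    rw [h1.fderiv_eq, ContinuousLinearMap.fderiv]
    simp
  · intro N
    simp_rw [hg, norm_mul]
    rw [integral_const_mul]
    exact mul_le_mul_of_nonneg_left (hB N) (abs_nonneg A)
  · intro j
    simpa using ((tendsto_integral_symbolError hβ hm i (𝓕 f) j).const_mul
      ((2 * Real.pi) ^ j)).const_mul (2 * Real.pi)
  · intro j N x
    set v : EuclideanSpace ℝ (Fin n) → ℂ :=
      fun ξ => (symbolError (n + 1 - α) n i N ξ : ℂ) * (𝓕 f) ξ with hv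
    have hvi : ∀ j : ℕ, Integrable fun ξ => ‖ξ‖ ^ j * ‖v ξ‖ :=
      integrable_pow_mul_symbolError_mul hβ hm i N (𝓕 f)
    have hvm : AEStronglyMeasurable v := by
      have h3 := measurable_symbolError hβ n i N
      have h4 := (𝓕 f).continuous.measurable
      exact Measurable.aestronglyMeasurable (by fun_prop)
    have hsm : ContDiff ℝ ∞ fun x => kernelConv α i (g N) x - φ x :=
      (kernelConv_contDiff hαn i (g N)).sub hφs
    have h1 : (fun x => ((kernelConv α i (g N) x - φ x : ℝ) : ℂ))
        = fun x => (2 * Real.pi * Complex.I : ℂ) • 𝓕⁻ v x := by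
      funext x
      rw [Complex.ofReal_sub, hgc, hφf, hA N hψ hf, smul_eq_mul]
    have h2 := Complex.ofRealLI.norm_iteratedFDeriv_comp_left (hsm.contDiffAt (x := x))
      (i := j) (mod_cast le_top)
    rw [← h2]
    have h3 : ⇑Complex.ofRealLI ∘ (fun x => kernelConv α i (g N) x - φ x)
        = fun x => (2 * Real.pi * Complex.I : ℂ) • 𝓕⁻ v x := h1
    rw [h3, iteratedFDeriv_const_smul_apply'
      (((contDiff_fourierInv hvi).of_le (mod_cast le_top)).contDiffAt), norm_smul]
    refine mul_le_mul (le_of_eq ?_) (norm_iteratedFDeriv_fourierInv_le hvi hvm j x)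
      (norm_nonneg _) (by positivity)
    simp [abs_of_pos Real.pi_pos]

end ApproximatePreimage

/-! ### Scaling, duality and the bound for the capacity. -/

section Capacity

variable {n : ℕ}

/-- The test function `x ↦ u ((x - x₀) / l)`. -/
noncomputable def rescale {V : Type*} [NormedAddCommGroup V] [NormedSpace ℝ V]
    (u : 𝓓((⊤ : Opens V), ℝ)) (x₀ : V) {l : ℝ} (hl : 0 < l) : 𝓓((⊤ : Opens V), ℝ) where
  toFun := fun x => u (l⁻¹ • (x - x₀))
  contDiff' := u.contDiff.comp (contDiff_const.smul (contDiff_id.sub contDiff_const))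
  hasCompactSupport' := u.hasCompactSupport.comp_homeomorph
    ((Homeomorph.subRight x₀).trans (Homeomorph.smulOfNeZero l⁻¹ (inv_ne_zero hl.ne')))
  tsupport_subset' := by simp

theorem rescale_apply {V : Type*} [NormedAddCommGroup V] [NormedSpace ℝ V]
    (u : 𝓓((⊤ : Opens V), ℝ)) (x₀ : V) {l : ℝ} (hl : 0 < l) (x : V) :
    rescale u x₀ hl x = u (l⁻¹ • (x - x₀)) := rfl

theorem norm_iteratedFDeriv_comp_smul_sub {V : Type*} [NormedAddCommGroup V] [NormedSpace ℝ V]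
    {F : V → ℝ} (hF : ContDiff ℝ ∞ F) (j : ℕ) (a : ℝ) (x₀ x : V) :
    ‖iteratedFDeriv ℝ j (fun x => F (a • (x - x₀))) x‖
      = |a| ^ j * ‖iteratedFDeriv ℝ j F (a • (x - x₀))‖ := by
  have h1 := congrFun (iteratedFDeriv_comp_sub' (𝕜 := ℝ) (f := fun y => F (a • y)) j x₀) x
  rw [h1, iteratedFDeriv_comp_const_smul a (hF.of_le (mod_cast le_top)), norm_smul, norm_pow,
    Real.norm_eq_abs]

theorem kernel_smul (α : ℝ) (i : Fin n) {l : ℝ} (hl : 0 < l) (x : EuclideanSpace ℝ (Fin n)) :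
    kernel α i (l • x) = l ^ (-α) * kernel α i x := by
  rw [kernel, kernel, norm_smul, Real.norm_of_nonneg hl.le, Real.mul_rpow hl.le (norm_nonneg _),
    Real.rpow_add hl, Real.rpow_one, Real.rpow_neg hl.le]
  simp only [PiLp.smul_apply, smul_eq_mul]
  field_simp

theorem integral_comp_inv_smul_sub (f : EuclideanSpace ℝ (Fin n) → ℝ)
    (x₀ : EuclideanSpace ℝ (Fin n)) {l : ℝ} (hl : 0 < l) :
    ∫ x, f (l⁻¹ • (x - x₀)) = l ^ (n : ℝ) * ∫ x, f x := by
  rw [integral_sub_right_eq_self (fun x => f (l⁻¹ • x)) x₀,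
    Measure.integral_comp_inv_smul_of_nonneg volume f hl.le]
  simp

/-- The volume scales by `l^n` and the kernel is homogeneous of degree `-α`. -/
theorem kernelConv_rescale (α : ℝ) (i : Fin n)
    (u : 𝓓((⊤ : Opens (EuclideanSpace ℝ (Fin n))), ℝ)) (x₀ : EuclideanSpace ℝ (Fin n))
    {l : ℝ} (hl : 0 < l) (x : EuclideanSpace ℝ (Fin n)) :
    kernelConv α i (rescale u x₀ hl) x
      = l ^ (n - α) * kernelConv α i u (l⁻¹ • (x - x₀)) := by
  rw [kernelConv, kernelConv, convolution_def, convolution_def]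
  simp only [ContinuousLinearMap.mul_apply', rescale_apply]
  have h := integral_comp_inv_smul_sub
    (fun y => kernel α i y * u (l⁻¹ • (x - x₀) - y)) 0 hl
  simp only [sub_zero] at h
  rw [sub_eq_neg_add, Real.rpow_add hl, mul_assoc, ← h, ← integral_const_mul]
  congr 1
  ext y
  rw [← mul_assoc, ← kernel_smul α i hl, smul_inv_smul₀ hl.ne', ← smul_sub]
  congr 3
  abel

/-- The action of a function in the unit ball of `L^∞` is bounded by the `L^1` norm. -/
theorem InUnitBallLinfty.abs_le {S : 𝓓((⊤ : Opens (EuclideanSpace ℝ (Fin n))), ℝ) → ℝ}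
    (hS : InUnitBallLinfty S) (u : 𝓓((⊤ : Opens (EuclideanSpace ℝ (Fin n))), ℝ)) :
    |S u| ≤ ∫ x, ‖u x‖ := by
  obtain ⟨b, -, hb1, hb2⟩ := hS
  rw [hb2, ← Real.norm_eq_abs]
  refine norm_integral_le_of_norm_le ((u.continuous.integrable_of_hasCompactSupport
    u.hasCompactSupport).norm) ?_
  have h1 : ∀ᵐ x, ‖b x‖ₑ ≤ 1 := by
    rw [eLpNorm_exponent_top] at hb1
    filter_upwards [ae_le_eLpNormEssSup (f := b) (μ := volume)] with x hx
    exact hx.trans hb1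
  filter_upwards [h1] with x hx
  have : ‖b x‖ ≤ 1 := by
    rw [← ofReal_norm, ENNReal.ofReal_le_one] at hx
    exact hx
  rw [norm_mul]
  exact mul_le_of_le_one_left (norm_nonneg _) this

/-- The total mass of a distribution supported in a ball of radius `l` whose potential lies in the
unit ball of `L^∞` is at most a constant times `l ^ α`. -/
theorem abs_pairing_one_le {α : ℝ} (hαn : α < n) {i : Fin n} {B : ℝ}
    {φ : EuclideanSpace ℝ (Fin n) → ℝ}
    {g : ℕ → 𝓓((⊤ : Opens (EuclideanSpace ℝ (Fin n))), ℝ)} {δ : ℕ → ℕ → ℝ}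
    (hφ : ContDiff ℝ ∞ φ) (hφ1 : ∀ x ∈ Metric.ball 0 1, φ x = 1)
    (hg : ∀ N, ∫ x, ‖g N x‖ ≤ B) (hδ : ∀ j, Tendsto (δ j) atTop (𝓝 0))
    (h : ∀ j N x, ‖iteratedFDeriv ℝ j (fun x => kernelConv α i (g N) x - φ x) x‖ ≤ δ j N)
    {T : 𝓓'((⊤ : Opens (EuclideanSpace ℝ (Fin n))), ℝ)} (hTc : IsCompact (dsupport T))
    {x₀ : EuclideanSpace ℝ (Fin n)} {l : ℝ} (hl : 0 < l) (hT : dsupport T ⊆ Metric.ball x₀ l)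
    (hpot : InUnitBallLinfty (potential α i T)) :
    |pairing T (fun _ => 1)| ≤ B * l ^ α := by
  have haff : ContDiff ℝ ∞ fun x : EuclideanSpace ℝ (Fin n) => l⁻¹ • (x - x₀) := by
    fun_prop
  have h1 : pairing T (fun _ => 1) = pairing T (fun x => φ (l⁻¹ • (x - x₀))) := by
    refine pairing_congr hTc contDiff_const (hφ.comp haff) ?_
    filter_upwards [(Metric.isOpen_ball.mem_nhdsSet).2 hT] with x hx
    refine (hφ1 _ ?_).symm
    rw [mem_ball_zero_iff, norm_smul, norm_inv, Real.norm_of_nonneg hl.le, inv_mul_lt_one₀ hl]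
    exact mem_ball_iff_norm.1 hx
  -- The factor `l^(α - n)` cancels the one from `kernelConv_rescale`; in the `L^1` norm it meets
  -- the Jacobian `l^n` and leaves `l^α`.
  let u : ℕ → 𝓓((⊤ : Opens (EuclideanSpace ℝ (Fin n))), ℝ) := fun N =>
    l ^ (α - n) • rescale (g N) x₀ hl
  have hconv : ∀ N x, kernelConv α i (u N) x = kernelConv α i (g N) (l⁻¹ • (x - x₀)) := by
    intro N x
    have : (⇑(u N) : EuclideanSpace ℝ (Fin n) → ℝ) = l ^ (α - n) • ⇑(rescale (g N) x₀ hl) := rfl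
    rw [this, kernelConv, convolution_smul, Pi.smul_apply]
    change l ^ (α - n) • kernelConv α i (rescale (g N) x₀ hl) x = _
    rw [kernelConv_rescale, smul_eq_mul, ← mul_assoc, ← Real.rpow_add hl]
    simp
  have hlim : Tendsto (fun N => pairing T (kernelConv α i (u N))) atTop
      (𝓝 (pairing T (fun _ => 1))) := by
    rw [h1]
    refine tendsto_pairing hTc (fun N => kernelConv_contDiff hαn i (u N)) (hφ.comp haff)
      (fun j N => |l⁻¹| ^ j * δ j N) (fun j => by simpa using (hδ j).const_mul (|l⁻¹| ^ j)) ?_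
    intro j N x
    have hF : ContDiff ℝ ∞ (fun x => kernelConv α i (g N) x - φ x) :=
      (kernelConv_contDiff hαn i (g N)).sub hφ
    have h2 : (fun x => kernelConv α i (u N) x - φ (l⁻¹ • (x - x₀)))
        = fun x => (fun x => kernelConv α i (g N) x - φ x) (l⁻¹ • (x - x₀)) := by
      ext x
      rw [hconv]
    rw [h2, norm_iteratedFDeriv_comp_smul_sub hF]
    gcongr
    exact h j N _
  refine le_of_tendsto hlim.abs (Eventually.of_forall fun N => ?_)
  -- The duality: the pairing of `T` with `k * u N` is by definition the potential of `T` acting on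
  -- `u N`.
  refine (hpot.abs_le (u N)).trans ?_
  have h3 : ∀ x, ‖u N x‖ = l ^ (α - n) * ‖g N (l⁻¹ • (x - x₀))‖ := by
    intro x
    change ‖l ^ (α - n) • g N (l⁻¹ • (x - x₀))‖ = _
    rw [norm_smul, Real.norm_of_nonneg (Real.rpow_nonneg hl.le _)]
  simp_rw [h3]
  rw [integral_const_mul, integral_comp_inv_smul_sub (fun x => ‖g N x‖) x₀ hl, ← mul_assoc,
    ← Real.rpow_add hl, sub_add_cancel, mul_comm]
  exact mul_le_mul_of_nonneg_right (hg N) (Real.rpow_nonneg hl.le _)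

/-- The capacity is bounded by a constant times the diameter to the power `α`. -/
theorem exists_kappa_le {α : ℝ} (hα0 : 0 < α) (hαn : α < n) (i : Fin n) :
    ∃ B : ℝ, ∀ E : Set (EuclideanSpace ℝ (Fin n)), IsCompact E →
      kappa α i E ≤ ENNReal.ofReal (B * Metric.diam E ^ α) := by
  obtain ⟨B, φ, g, δ, hφ, hφ1, hg, hδ, h⟩ := exists_approximate_preimage hα0 hαn i
  refine ⟨B, fun E hE => iSup_le fun T => iSup_le fun hT => iSup_le fun hpot => ?_⟩
  apply ENNReal.ofReal_le_ofReal
  have hTc := isCompact_dsupport_of_subset hE hT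
  obtain ⟨x₀, hx₀⟩ : ∃ x₀, E ⊆ Metric.closedBall x₀ (Metric.diam E) := by
    rcases E.eq_empty_or_nonempty with rfl | ⟨x₀, hx₀⟩
    · exact ⟨0, Set.empty_subset _⟩
    · exact ⟨x₀, fun x hx => Metric.dist_le_diam_of_mem hE.isBounded hx hx₀⟩
  -- The preceding estimate needs an open ball of positive radius, so `l` decreases strictly to the
  -- diameter; this also covers diameter zero.
  have hlim : Tendsto (fun l : ℝ => B * l ^ α) (𝓝[>] (Metric.diam E))
      (𝓝 (B * Metric.diam E ^ α)) :=
    (((Real.continuous_rpow_const hα0.le).tendsto _).const_mul B).mono_left nhdsWithin_le_nhds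
  refine ge_of_tendsto hlim ?_
  filter_upwards [self_mem_nhdsWithin] with l hl
  exact abs_pairing_one_le hαn hφ hφ1 hg hδ h hTc (Metric.diam_nonneg.trans_lt hl)
    ((hT.trans hx₀).trans (Metric.closedBall_subset_ball hl)) hpot

end Capacity

end ScalarRiesz

theorem corollary15 (n : ℕ) (α : ℝ) (hα0 : 0 < α) (hαn : α < n) :
    ∃ C : ℝ, 0 < C ∧
      ∀ (i : Fin n) (E : Set (EuclideanSpace ℝ (Fin n))), IsCompact E →
        ScalarRiesz.kappa α i E ≤ ENNReal.ofReal (C * Metric.diam E ^ α) ∧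
        ScalarRiesz.kappa α i E < ⊤ := by
  choose B hB using fun i : Fin n => ScalarRiesz.exists_kappa_le hα0 hαn i
  -- The sum serves all coordinates at once; the `1` secures strict positivity.
  refine ⟨∑ i, |B i| + 1, by positivity, fun i E hE => ?_⟩
  have h : ScalarRiesz.kappa α i E ≤
      ENNReal.ofReal ((∑ i, |B i| + 1) * Metric.diam E ^ α) := by
    refine (hB i E hE).trans (ENNReal.ofReal_le_ofReal ?_)
    refine mul_le_mul_of_nonneg_right ?_ (Real.rpow_nonneg Metric.diam_nonneg _)
    have := Finset.single_le_sum (f := fun i => |B i|) (fun j _ => abs_nonneg (B j))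
      (Finset.mem_univ i)
    linarith [le_abs_self (B i)]
  exact ⟨h, h.trans_lt ENNReal.ofReal_lt_top⟩
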